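/- Let $T,d,L,M,N\ge 0$ be integers, $\mathbb T=\{0,\dots,T\}$, and let $(\Omega,\mathcal F,(\mathcal F_t)_{t\in\mathbb T},\mathbb P)$ be a filtered probability space with $\mathcal F$ separable. Let $S=(S_t)_{t\in\mathbb T}$ be adapted with values in $\mathbb R^d$ (stock prices), let $f=(f^1,\dots,f^L)$ be bounded $\mathcal F_T$-measurable random variables (European options, which can only be bought, at prices $\alpha\in\mathbb R^L$), and let $g=(g^1,\dots,g^M)$ and $h=(h^1,\dots,h^N)$ be bounded real-valued adapted processes indexed by $\mathbb T$ (American options; each $g^j$ can only be bought, at price $\beta^j\in\mathbb R$, and each $h^k$ can only be sold, at price $\gamma^k\in\mathbb R$). Let $n\in\{N,N+1\}$. The enlarged filtered probability space $\overline{\mathbb M}^n=(\overline\Omega^n,\overline{\mathcal F}^n_T,(\overline{\mathcal F}^n_t)_{t\in\mathbb T},\overline{\mathbb P}^n)$ is defined by $\overline\Omega^n=\Omega\times\mathbb T^n$, $\theta^k(\omega,t^1,\dots,t^n)=t^k$, $\overline{\mathcal F}^n_t=\sigma\big(A\times\mathbb T^n\ (A\in\mathcal F_t),\ \{\theta^k\le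 s\}\ (0\le s\le t,\ 1\le k\le n)\big)$ and $\overline{\mathbb P}^n=\mathbb P\otimes P^n$ (restricted to $\overline{\mathcal F}^n_T$), where $P^n$ is an arbitrary probability measure on $\mathbb T^n$ charging every point. For $\overline\omega=(\omega,t^1,\dots,t^n)$ put $\overline S_t(\overline\omega)=S_t(\omega)$, $\overline f(\overline\omega)=f(\omega)$, $\overline g_t(\overline\omega)=g_t(\omega)$ and $\overline{h}^k(\overline\omega)=h^k_{t^k}(\omega)$ for $k=1,\dots,N$. A semi-static strategy is a quintuple $(H,a,b,\mu,c)$ in which $H=(H_t)_{t\in\mathbb T}$ is an $\mathbb R^d$-valued $(\overline{\mathcal F}^n_t)$-adapted process, $(a,b,c)\in\mathbb R_+^L\times\mathbb R_+^M\times\mathbb R_+^N$, and $\mu=(\mu^1,\dots,\mu^M)$ consists of liquidating strategies, i.e. each $\mu^j=(\mu^j_t)_{t\in\mathbb T}$ is $(\overline{\mathcal F}^n_t)$-adapted with $\mu^j_t\ge 0$ and $\sum_{t=0}^T\mu^j_t=1$. Its payoff at prices $(\alpha,\beta,\gamma)$ is $$\overline\Phi_{\alpha,\beta,\gamma}=\sum_{t=0}^{T-1}H_t\cdot(\overline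 S_{t+1}-\overline S_t)+\sum_{i=1}^L a^i(\overline f^i-\alpha^i)+\sum_{j=1}^M b^j\Big(\sum_{t=0}^T\overline g^j_t\mu^j_t-\beta^j\Big)-\sum_{k=1}^N c^k(\overline h^k-\gamma^k).$$ No-arbitrage (NA) holds in $\overline{\mathbb M}^n$ at prices $(\alpha,\beta,\gamma)$ if, for every semi-static strategy, $\overline\Phi_{\alpha,\beta,\gamma}\ge 0$ $\overline{\mathbb P}^n$-a.s. implies $\overline\Phi_{\alpha,\beta,\gamma}=0$ $\overline{\mathbb P}^n$-a.s. Strict no-arbitrage (SNA) holds in $\overline{\mathbb M}^n$ if there is $\varepsilon>0$ such that NA holds at the prices $(\alpha-\varepsilon,\beta-\varepsilon,\gamma+\varepsilon)$, where $\varepsilon$ is subtracted from or added to every component. Theorem (FTAP). For $n=N$ and for $n=N+1$, SNA holds in $\overline{\mathbb M}^n$ if and only if there is a probability measure $Q$ on $(\overline\Omega^n,\overline{\mathcal F}^n_T)$, equivalent to $\overline{\mathbb P}^n$, such that $\overline S$ is a $Q$-martingale with respect to $(\overline{\mathcal F}^n_t)_{t\in\mathbb T}$ and $$E_Q[\overline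 f^i]<\alpha^i\ (i\le L),\qquad E_Q[\overline h^k]>\gamma^k\ (k\le N),\qquad \sup_{\tau}E_Q[\overline g^j_\tau]<\beta^j\ (j\le M),$$ where the supremum is over all $(\overline{\mathcal F}^n_t)$-stopping times $\tau$ with values in $\mathbb T$. -/

import Mathlib

open MeasureTheory

/-- The data of the original market with horizon `T` on a filtered measurable space
`(Ω, ℱ, (ℱ_t)_{t = 0, …, T})`: the `ℝ^d`-valued adapted stock price process `S`, bounded
`ℱ_T`-measurable European payoffs `f^i`, `i < L`, and bounded adapted payoff processes of the
American options `g^j`, `j < M` (to be bought) and `h^k`, `k < N` (to be sold). -/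
structure Market (Ω : Type*) [mΩ : MeasurableSpace Ω] (T d L M N : ℕ) where
  filt : Filtration (Fin (T + 1)) mΩ
  S : Fin (T + 1) → Ω → EuclideanSpace ℝ (Fin d)
  S_adapted : StronglyAdapted filt S
  f : Fin L → Ω → ℝ
  f_measurable : ∀ i, StronglyMeasurable[filt (Fin.last T)] (f i)
  f_bounded : ∃ C : ℝ, ∀ i ω, |f i ω| ≤ C
  g : Fin M → Fin (T + 1) → Ω → ℝ
  g_adapted : ∀ j, StronglyAdapted filt (g j)
  g_bounded : ∃ C : ℝ, ∀ j t ω, |g j t ω| ≤ C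
  h : Fin N → Fin (T + 1) → Ω → ℝ
  h_adapted : ∀ k, StronglyAdapted filt (h k)
  h_bounded : ∃ C : ℝ, ∀ k t ω, |h k t ω| ≤ C

/-- The enlarged sample space `Ω × {0, …, T}^n`: an outcome of `Ω` together with the exercise
times of `n` shorted American options. The filtration is a parameter only because the
σ-algebra put on this space below depends on it. -/
structure EnlargedSpace {Ω : Type*} [mΩ : MeasurableSpace Ω] {T : ℕ}
    (𝔽 : Filtration (Fin (T + 1)) mΩ) (n : ℕ) where
  outcome : Ω
  exercise : Fin n → Fin (T + 1)

section Enlarged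

variable {Ω : Type*} [mΩ : MeasurableSpace Ω] {T d L M N : ℕ}

/-- `σ(ℱ_t × {0, …, T}^n, {θ^k ≤ s}, s = 0, …, t, k = 1, …, n)`, where `θ^k` is the `k`-th
exercise time. -/
@[reducible]
def enlargedSigma (𝔽 : Filtration (Fin (T + 1)) mΩ) (n : ℕ) (t : Fin (T + 1)) :
    MeasurableSpace (EnlargedSpace 𝔽 n) :=
  (𝔽 t).comap EnlargedSpace.outcome ⊔
    MeasurableSpace.generateFrom
      {A | ∃ (k : Fin n) (s : Fin (T + 1)), s ≤ t ∧ A = {x | x.exercise k ≤ s}}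

/-- The σ-algebra of the enlarged space is the terminal one of the enlarged filtration. -/
instance EnlargedSpace.instMeasurableSpace (𝔽 : Filtration (Fin (T + 1)) mΩ) (n : ℕ) :
    MeasurableSpace (EnlargedSpace 𝔽 n) :=
  enlargedSigma 𝔽 n (Fin.last T)

theorem enlargedSigma_mono (𝔽 : Filtration (Fin (T + 1)) mΩ) (n : ℕ) :
    Monotone (enlargedSigma 𝔽 n) := by
  intro s t hst
  refine sup_le_sup (MeasurableSpace.comap_mono (𝔽.mono hst))
    (MeasurableSpace.generateFrom_mono ?_)
  rintro A ⟨k, r, hr, rfl⟩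
  exact ⟨k, r, hr.trans hst, rfl⟩

/-- The enlarged filtration. -/
def enlargedFiltration (𝔽 : Filtration (Fin (T + 1)) mΩ) (n : ℕ) :
    Filtration (Fin (T + 1)) (EnlargedSpace.instMeasurableSpace 𝔽 n) where
  seq := enlargedSigma 𝔽 n
  mono' := enlargedSigma_mono 𝔽 n
  le' t := enlargedSigma_mono 𝔽 n (Fin.le_last t)

theorem measurable_enlargedSpace_mk (𝔽 : Filtration (Fin (T + 1)) mΩ) (n : ℕ) :
    Measurable (fun p : Ω × (Fin n → Fin (T + 1)) =>
      (EnlargedSpace.mk p.1 p.2 : EnlargedSpace 𝔽 n)) := by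
  rw [measurable_iff_comap_le]
  change MeasurableSpace.comap _ (_ ⊔ _) ≤ _
  rw [MeasurableSpace.comap_sup, sup_le_iff]
  constructor
  · rw [MeasurableSpace.comap_comp, ← measurable_iff_comap_le]
    exact measurable_fst.mono le_rfl (𝔽.le _)
  · rw [MeasurableSpace.comap_generateFrom]
    refine MeasurableSpace.generateFrom_le ?_
    rintro _ ⟨_, ⟨k, s, -, rfl⟩, rfl⟩
    have hk : Measurable (fun p : Ω × (Fin n → Fin (T + 1)) => p.2 k) :=
      (measurable_pi_apply k).comp measurable_snd
    exact hk (MeasurableSet.of_discrete (s := Set.Iic s))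

/-- The measure `P ⊗ R` on the enlarged space, `P` being a measure on `Ω` and `R` one on
`{0, …, T}^n`. -/
noncomputable def enlargedMeasure (𝔽 : Filtration (Fin (T + 1)) mΩ) {n : ℕ} (P : Measure Ω)
    (R : Measure (Fin n → Fin (T + 1))) : Measure (EnlargedSpace 𝔽 n) :=
  (P.prod R).map (fun p => EnlargedSpace.mk p.1 p.2)

instance enlargedMeasure.instIsProbabilityMeasure (𝔽 : Filtration (Fin (T + 1)) mΩ) {n : ℕ}
    (P : Measure Ω) (R : Measure (Fin n → Fin (T + 1))) [IsProbabilityMeasure P]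
    [IsProbabilityMeasure R] : IsProbabilityMeasure (enlargedMeasure 𝔽 P R) :=
  Measure.isProbabilityMeasure_map (measurable_enlargedSpace_mk 𝔽 n).aemeasurable

/-- Liquidating strategies of a filtration: nonnegative adapted processes with sum `1`. -/
def IsLiquidatingStrategy {X : Type*} {mX : MeasurableSpace X}
    (𝔾 : Filtration (Fin (T + 1)) mX) (η : Fin (T + 1) → X → ℝ) : Prop :=
  StronglyAdapted 𝔾 η ∧ (∀ t x, 0 ≤ η t x) ∧ ∀ x, ∑ t, η t x = 1

namespace Market

variable (𝓜 : Market Ω T d L M N) (n : ℕ)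

/-- Extension of the stock price to the enlarged space. -/
def enlS (t : Fin (T + 1)) (x : EnlargedSpace 𝓜.filt n) : EuclideanSpace ℝ (Fin d) :=
  𝓜.S t x.outcome

/-- Extension of the European options to the enlarged space. -/
def enlF (i : Fin L) (x : EnlargedSpace 𝓜.filt n) : ℝ :=
  𝓜.f i x.outcome

/-- Extension of the longed American options to the enlarged space. -/
def enlG (j : Fin M) (t : Fin (T + 1)) (x : EnlargedSpace 𝓜.filt n) : ℝ :=
  𝓜.g j t x.outcome

/-- Extension of the shorted American options to the enlarged space, where they become European
options: the `k`-th one pays `h^k` at the `k`-th exercise time. -/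
def enlH {n : ℕ} (hNn : N ≤ n) (k : Fin N) (x : EnlargedSpace 𝓜.filt n) : ℝ :=
  𝓜.h k (x.exercise (Fin.castLE hNn k)) x.outcome

/-- Semi-static trading strategies `(H, a, b, μ, c)` in the enlarged space. -/
structure Strategy where
  H : Fin (T + 1) → EnlargedSpace 𝓜.filt n → EuclideanSpace ℝ (Fin d)
  H_adapted : StronglyAdapted (enlargedFiltration 𝓜.filt n) H
  a : Fin L → ℝ
  a_nonneg : ∀ i, 0 ≤ a i
  b : Fin M → ℝ
  b_nonneg : ∀ j, 0 ≤ b j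
  μ : Fin M → Fin (T + 1) → EnlargedSpace 𝓜.filt n → ℝ
  μ_liquidating : ∀ j, IsLiquidatingStrategy (enlargedFiltration 𝓜.filt n) (μ j)
  c : Fin N → ℝ
  c_nonneg : ∀ k, 0 ≤ c k

variable {n}

/-- The payoff `H ⬝ S + a (f - α) + b (μ(g) - β) - c (h - γ)` of a semi-static strategy. -/
noncomputable def payoff (hNn : N ≤ n) (α : Fin L → ℝ) (β : Fin M → ℝ) (γ : Fin N → ℝ)
    (A : 𝓜.Strategy n) (x : EnlargedSpace 𝓜.filt n) : ℝ :=
  (∑ t : Fin T, inner ℝ (A.H t.castSucc x) (𝓜.enlS n t.succ x - 𝓜.enlS n t.castSucc x))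
    + (∑ i, A.a i * (𝓜.enlF n i x - α i))
    + (∑ j, A.b j * ((∑ t, 𝓜.enlG n j t x * A.μ j t x) - β j))
    - (∑ k, A.c k * (𝓜.enlH hNn k x - γ k))

/-- No arbitrage in the enlarged space with reference measure `Pbar` and prices `α, β, γ`. -/
def NoArbitrage (hNn : N ≤ n) (Pbar : Measure (EnlargedSpace 𝓜.filt n))
    (α : Fin L → ℝ) (β : Fin M → ℝ) (γ : Fin N → ℝ) : Prop :=
  ∀ A : 𝓜.Strategy n, (∀ᵐ x ∂Pbar, 0 ≤ 𝓜.payoff hNn α β γ A x) →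
    ∀ᵐ x ∂Pbar, 𝓜.payoff hNn α β γ A x = 0

/-- Strict no arbitrage in the enlarged space. -/
def StrictNoArbitrage (hNn : N ≤ n) (Pbar : Measure (EnlargedSpace 𝓜.filt n))
    (α : Fin L → ℝ) (β : Fin M → ℝ) (γ : Fin N → ℝ) : Prop :=
  ∃ ε : ℝ, 0 < ε ∧
    𝓜.NoArbitrage hNn Pbar (fun i => α i - ε) (fun j => β j - ε) (fun k => γ k + ε)

variable (n) in
/-- Stopping times of the enlarged filtration, with values in `{0, …, T}`. -/
def StoppingTimes : Type _ :=
  {τ : EnlargedSpace 𝓜.filt n → Fin (T + 1) //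
    IsStoppingTime (enlargedFiltration 𝓜.filt n) (fun x => (τ x : WithTop (Fin (T + 1))))}

/-- The equivalent martingale measures `Q` with `E_Q[f] < α`, `E_Q[h] > γ` and
`sup_τ E_Q[g_τ] < β` componentwise. -/
def martingaleMeasures (hNn : N ≤ n) (Pbar : Measure (EnlargedSpace 𝓜.filt n))
    (α : Fin L → ℝ) (β : Fin M → ℝ) (γ : Fin N → ℝ) : Set (Measure (EnlargedSpace 𝓜.filt n)) :=
  {Q | IsProbabilityMeasure Q ∧ Q ≪ Pbar ∧ Pbar ≪ Q ∧
    Martingale (𝓜.enlS n) (enlargedFiltration 𝓜.filt n) Q ∧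
    (∀ i, (∫ x, 𝓜.enlF n i x ∂Q) < α i) ∧
    (∀ k, γ k < ∫ x, 𝓜.enlH hNn k x ∂Q) ∧
    ∀ j, (⨆ τ : 𝓜.StoppingTimes n, ∫ x, 𝓜.enlG n j (τ.1 x) x ∂Q) < β j}

end Market

end Enlarged

/-! On the enlarged space the shorted American options are European claims, so the statement becomes
a fundamental theorem on one filtered space with stocks, European claims (`netEuropean`, net of
price) and American claims that can only be bought (`netAmerican`).

From SNA to a measure. If NA holds with margin `ε`, then with margin `ε / 2` no nonzero option
position can be hedged without risk of loss: it would earn a sure extra amount at margin `ε`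
(`optionsAtRisk_of_noArbitrage`). Two closedness results follow. The stock gains minus nonnegative
functions are closed under a.e. convergence (`aeclosed_dominated_gains`): the scalar increments are
adjoined one at a time, from the latest date to the earliest, and where the coefficients diverge, no
arbitrage makes the new generator redundant (`IsModuleOver.aeclosed_adjoin`). Adding option
positions keeps the cone closed (`aeclosed_claimCone`): normalised positions have convergent convex
combinations, and the risk property prevents the original positions from blowing up. After a change
to an equivalent measure under which prices are square integrable, the Kreps–Yan theorem
(`kreps_yan`) gives a strictly positive functional that is nonpositive on the cone; normalised, it
is the density of `Q`. The margin `ε / 2` that remains makes the pricing inequalities strict, also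
for the supremum over stopping times.

From a measure to SNA. Finitely many strict inequalities leave room for a common `ε`. Options being
bounded, a nonnegative total payoff bounds the stock gains below, so these are `Q`-integrable with
nonpositive mean (`integral_gains_nonpos`). A liquidating strategy is a mixture of stopping times,
hence worth no more than the best of them (`integral_exercise_le`). The payoff is thus nonnegative
with nonpositive mean, and vanishes. -/

namespace FTAP

open Filter Topology

/-! ### Modules and cones of claims. -/

section Definitions

variable {X : Type*}

/-- A set of functions is closed under almost everywhere convergence of sequences. -/
def AEClosed {mX : MeasurableSpace X} (μ : Measure X) (D : Set (X → ℝ)) : Prop :=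
  ∀ (Y : ℕ → X → ℝ) (Z : X → ℝ), (∀ n, Y n ∈ D) →
    (∀ᵐ x ∂μ, Tendsto (fun n => Y n x) atTop (𝓝 (Z x))) → Z ∈ D

/-- The functions that are dominated almost everywhere by an element of `L`. -/
def dominated {mX : MeasurableSpace X} (μ : Measure X) (L : Set (X → ℝ)) : Set (X → ℝ) :=
  {Y | ∃ l ∈ L, Y ≤ᵐ[μ] l}

/-- A set of real functions is a module over the `m`-measurable real functions. -/
structure IsModuleOver (m : MeasurableSpace X) (L : Set (X → ℝ)) : Prop where
  zero_mem : (fun _ => 0) ∈ L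
  add_mem : ∀ {k l : X → ℝ}, k ∈ L → l ∈ L → (fun x => k x + l x) ∈ L
  mul_mem : ∀ {φ l : X → ℝ}, Measurable[m] φ → l ∈ L → (fun x => φ x * l x) ∈ L

/-- The span of `L` and of a further generator `ξ` over the `m`-measurable functions. -/
def adjoin (m : MeasurableSpace X) (L : Set (X → ℝ)) (ξ : X → ℝ) : Set (X → ℝ) :=
  {Y | ∃ l ∈ L, ∃ φ : X → ℝ, Measurable[m] φ ∧ Y = fun x => l x + φ x * ξ x}

/-- No element of `L` is nonnegative and nontrivial. -/
def ArbitrageFree {mX : MeasurableSpace X} (μ : Measure X) (L : Set (X → ℝ)) : Prop :=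
  ∀ l ∈ L, (∀ᵐ x ∂μ, 0 ≤ l x) → ∀ᵐ x ∂μ, l x = 0

end Definitions

/-! ### Closedness of the cone of dominated stock gains. -/

section Closedness

variable {X : Type*} {mX : MeasurableSpace X} {μ : Measure X} {m : MeasurableSpace X} {L : Set (X → ℝ)}

theorem IsModuleOver.dominated_add (hL : IsModuleOver m L) {Y Z : X → ℝ}
    (hY : Y ∈ dominated μ L) (hZ : Z ∈ dominated μ L) :
    (fun x => Y x + Z x) ∈ dominated μ L := by
  obtain ⟨k, hk, hYk⟩ := hY
  obtain ⟨l, hl, hZl⟩ := hZ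
  refine ⟨_, hL.add_mem hk hl, ?_⟩
  filter_upwards [hYk, hZl] with x h1 h2 using add_le_add h1 h2

theorem IsModuleOver.dominated_mul (hL : IsModuleOver m L) {φ Y : X → ℝ} (hφ : Measurable[m] φ)
    (hφ0 : ∀ x, 0 ≤ φ x) (hY : Y ∈ dominated μ L) :
    (fun x => φ x * Y x) ∈ dominated μ L := by
  obtain ⟨k, hk, hYk⟩ := hY
  refine ⟨_, hL.mul_mem hφ hk, ?_⟩
  filter_upwards [hYk] with x h1 using mul_le_mul_of_nonneg_left h1 (hφ0 x)

/-- The sets `{N = K}` are `m`-measurable, so finitely many pieces can be pasted inside the cone. At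
each point the partial pastings are eventually constant, and closedness gives the full pasting. -/
theorem IsModuleOver.dominated_random_index (hL : IsModuleOver m L)
    (hcl : AEClosed μ (dominated μ L)) {d : ℕ → X → ℝ} (hd : ∀ n, d n ∈ dominated μ L)
    {N : X → ℕ} (hN : Measurable[m] N) : (fun x => d (N x) x) ∈ dominated μ L := by
  classical
  have hpart : ∀ K, (fun x => if N x < K then d (N x) x else 0) ∈ dominated μ L := by
    intro K
    induction K with
    | zero => simpa using ⟨_, hL.zero_mem, EventuallyLE.refl _ _⟩
    | succ K ih =>
      have hφ : Measurable[m] (fun x => if N x = K then (1 : ℝ) else 0) :=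
        Measurable.ite (hN (measurableSet_singleton K)) measurable_const measurable_const
      have h1 := hL.dominated_add ih
        (hL.dominated_mul hφ (fun x => by split_ifs <;> norm_num) (hd K))
      convert h1 using 2 with x
      rcases lt_trichotomy (N x) K with h | h | h
      · simp [h, h.ne, h.trans (Nat.lt_succ_self K)]
      · simp [h]
      · simp [not_lt.2 h.le, h.ne', not_lt.2 (Nat.succ_le_of_lt h)]
  refine hcl _ _ hpart (ae_of_all _ fun x => ?_)
  refine tendsto_const_nhds.congr' ?_
  filter_upwards [eventually_gt_atTop (N x)] with K hK
  simp [hK]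

/-- A bounded sequence of measurable functions clusters pointwise at its upper limit, along
measurable indices. -/
theorem exists_measurable_index {u : ℕ → X → ℝ} (hu : ∀ n, Measurable[m] (u n)) {B : ℝ}
    (hB : ∀ n x, |u n x| ≤ B) :
    ∃ ℓ : X → ℝ, Measurable[m] ℓ ∧ (∀ x, |ℓ x| ≤ B) ∧ ∃ N : ℕ → X → ℕ, (∀ k, Measurable[m] (N k)) ∧
      (∀ k x, k ≤ N k x) ∧ ∀ x, Tendsto (fun k => u (N k x) x) atTop (𝓝 (ℓ x)) := by
  classical
  have hbdd : ∀ x, IsBoundedUnder (· ≤ ·) atTop (fun n => u n x) := fun x =>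
    isBoundedUnder_of ⟨B, fun n => (abs_le.1 (hB n x)).2⟩
  have hbdd' : ∀ x, IsBoundedUnder (· ≥ ·) atTop (fun n => u n x) := fun x =>
    isBoundedUnder_of ⟨-B, fun n => (abs_le.1 (hB n x)).1⟩
  set ℓ : X → ℝ := fun x => limsup (fun n => u n x) atTop with hℓ
  have hℓm : Measurable[m] ℓ := Measurable.limsup hu
  have hex : ∀ (k : ℕ) x, ∃ n, k ≤ n ∧ |u n x - ℓ x| < 1 / ((k : ℝ) + 1) := by
    intro k x
    have hpos : (0 : ℝ) < 1 / ((k : ℝ) + 1) := by positivity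
    have h1 : ∃ᶠ n in atTop, ℓ x - 1 / ((k : ℝ) + 1) < u n x :=
      frequently_lt_of_lt_limsup (hbdd' x).isCoboundedUnder_le (by simp only [hℓ] at *; linarith)
    have h2 : ∀ᶠ n in atTop, u n x < ℓ x + 1 / ((k : ℝ) + 1) :=
      eventually_lt_of_limsup_lt (by simp only [hℓ]; linarith) (hbdd x)
    obtain ⟨n, h3, h4, h5⟩ := (h1.and_eventually (h2.and (eventually_ge_atTop k))).exists
    exact ⟨n, h5, abs_lt.2 ⟨by linarith, by linarith⟩⟩
  refine ⟨ℓ, hℓm, fun x => ?_, fun k x => Nat.find (hex k x), fun k => ?_, fun k x => ?_,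
    fun x => ?_⟩
  · refine abs_le.2 ⟨?_, ?_⟩
    · exact le_limsup_of_frequently_le
        (Frequently.of_forall fun n => (abs_le.1 (hB n x)).1) (hbdd x)
    · exact limsup_le_of_le (hbdd' x).isCoboundedUnder_le
        (Eventually.of_forall fun n => (abs_le.1 (hB n x)).2)
  · refine @measurable_find X m (fun x n => k ≤ n ∧ |u n x - ℓ x| < 1 / ((k : ℝ) + 1)) _
      (hex k) fun n => ?_
    refine (MeasurableSet.const _).inter ?_
    exact measurableSet_lt (((hu n).sub hℓm).abs) measurable_const
  · exact (Nat.find_spec (hex k x)).1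
  · rw [tendsto_iff_dist_tendsto_zero]
    refine squeeze_zero (fun _ => dist_nonneg) (fun k => ?_)
      (tendsto_one_div_add_atTop_nhds_zero_nat (𝕜 := ℝ))
    rw [Real.dist_eq]
    exact (Nat.find_spec (hex k x)).2.le

theorem measurable_random_index {φ : ℕ → X → ℝ} (hφ : ∀ n, Measurable[m] (φ n)) {N : X → ℕ}
    (hN : Measurable[m] N) : Measurable[m] (fun x => φ (N x) x) := by
  have h : Measurable (fun p : ℕ × X => φ p.1 p.2) := measurable_from_prod_countable_right hφ
  exact h.comp (hN.prodMk measurable_id)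

/-- Adjoining one generator to a module preserves the closedness of the cone of dominated
functions, as long as the result is free of arbitrage. -/
theorem IsModuleOver.aeclosed_adjoin (hL : IsModuleOver m L)
    (hcl : AEClosed μ (dominated μ L)) {ξ : X → ℝ} (hNA : ArbitrageFree μ (adjoin m L ξ)) :
    AEClosed μ (dominated μ (adjoin m L ξ)) := by
  classical
  intro Y Z hY hYZ
  choose w hw hYw using hY
  choose l hl φ hφ hw' using hw
  -- The arctangent compactifies the coefficients: along measurable random indices `φ` has a limit
  -- in `[-∞, ∞]` at every point, infinite exactly where `|ℓ| = π / 2`.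
  have hu : ∀ n, Measurable[m] (fun x => Real.arctan (φ n x)) := fun n =>
    Real.measurable_arctan.comp (hφ n)
  obtain ⟨ℓ, hℓ, hℓB, N, hN, hkN, hNℓ⟩ := exists_measurable_index hu (B := Real.pi / 2)
    fun n x => abs_le.2 ⟨(Real.neg_pi_div_two_lt_arctan _).le, (Real.arctan_lt_pi_div_two _).le⟩
  set d : ℕ → X → ℝ := fun n x => Y n x - φ n x * ξ x with hd
  have hdD : ∀ n, d n ∈ dominated μ L := fun n => ⟨l n, hl n, by
    filter_upwards [hYw n] with x hx
    rw [hw'] at hx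
    simp only [hd]; linarith⟩
  have hdN : ∀ k, (fun x => d (N k x) x) ∈ dominated μ L := fun k =>
    hL.dominated_random_index hcl hdD (hN k)
  have hφN : ∀ k, Measurable[m] (fun x => φ (N k x) x) := fun k =>
    measurable_random_index hφ (hN k)
  have hNtop : ∀ x, Tendsto (fun k => N k x) atTop atTop := fun x =>
    tendsto_atTop_mono (fun k => hkN k x) tendsto_id
  have hYN : ∀ᵐ x ∂μ, Tendsto (fun k => Y (N k x) x) atTop (𝓝 (Z x)) := by
    filter_upwards [hYZ] with x hx using hx.comp (hNtop x)
  have hcosmid : ∀ x, |ℓ x| < Real.pi / 2 →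
      Tendsto (fun k => φ (N k x) x) atTop (𝓝 (Real.tan (ℓ x))) := by
    intro x hx
    have hc : Real.cos (ℓ x) ≠ 0 := (Real.cos_pos_of_mem_Ioo (abs_lt.1 hx)).ne'
    have := ((Real.continuousAt_tan.2 hc).tendsto).comp (hNℓ x)
    simpa [Function.comp_def, Real.tan_arctan] using this
  have htop : ∀ x, ℓ x = Real.pi / 2 → Tendsto (fun k => φ (N k x) x) atTop atTop := by
    intro x hx
    rw [tendsto_atTop]
    intro b
    have h1 := (hNℓ x).eventually (eventually_gt_nhds (hx ▸ Real.arctan_lt_pi_div_two b))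
    filter_upwards [h1] with k hk
    exact (Real.arctan_strictMono.lt_iff_lt.1 hk).le
  have hbot : ∀ x, ℓ x = -(Real.pi / 2) → Tendsto (fun k => φ (N k x) x) atTop atBot := by
    intro x hx
    rw [tendsto_atBot]
    intro b
    have h1 := (hNℓ x).eventually
      (eventually_lt_nhds (hx ▸ Real.neg_pi_div_two_lt_arctan b))
    filter_upwards [h1] with k hk
    exact (Real.arctan_strictMono.lt_iff_lt.1 hk).le
  have hmid_m : MeasurableSet[m] {x | |ℓ x| < Real.pi / 2} :=
    measurableSet_lt hℓ.abs measurable_const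
  have htop_m : MeasurableSet[m] {x | ℓ x = Real.pi / 2} := hℓ (measurableSet_singleton _)
  have hbot_m : MeasurableSet[m] {x | ℓ x = -(Real.pi / 2)} := hℓ (measurableSet_singleton _)
  have hpi := Real.pi_pos
  -- the part where the coefficients converge
  have hmid : (fun x => (if |ℓ x| < Real.pi / 2 then (1 : ℝ) else 0) *
      (Z x - Real.tan (ℓ x) * ξ x)) ∈ dominated μ L := by
    refine hcl (fun k x => (if |ℓ x| < Real.pi / 2 then (1 : ℝ) else 0) * d (N k x) x) _
      (fun k => hL.dominated_mul (Measurable.ite hmid_m measurable_const measurable_const)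
        (fun x => by split_ifs <;> norm_num) (hdN k)) ?_
    filter_upwards [hYN] with x hx
    by_cases h : |ℓ x| < Real.pi / 2
    · simp only [h, if_true, one_mul, hd]
      exact hx.sub ((hcosmid x h).mul_const _)
    · simp [h]
  -- the parts where they diverge
  have hpos : (fun x => (if ℓ x = Real.pi / 2 then (1 : ℝ) else 0) * (-ξ x)) ∈ dominated μ L := by
    refine hcl (fun k x => ((if ℓ x = Real.pi / 2 then (1 : ℝ) else 0) *
      (max (φ (N k x) x) 1)⁻¹) * d (N k x) x) _
      (fun k => hL.dominated_mul ((Measurable.ite htop_m measurable_const measurable_const).mul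
        ((hφN k).max measurable_const).inv)
        (fun x => mul_nonneg (by split_ifs <;> norm_num) (by positivity)) (hdN k)) ?_
    filter_upwards [hYN] with x hx
    by_cases h : ℓ x = Real.pi / 2
    · simp only [h, if_true, one_mul, hd]
      have h1 := tendsto_inv_atTop_zero.comp (htop x h)
      have h2 := (h1.mul hx).sub_const (ξ x)
      rw [zero_mul, zero_sub] at h2
      refine h2.congr' ?_
      filter_upwards [(htop x h).eventually_ge_atTop 1] with k hk
      simp only [Function.comp_apply, max_eq_left hk]
      have : φ (N k x) x ≠ 0 := by linarith
      field_simp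
    · simp [h]
  have hneg : (fun x => (if ℓ x = -(Real.pi / 2) then (1 : ℝ) else 0) * ξ x) ∈
      dominated μ L := by
    refine hcl (fun k x => ((if ℓ x = -(Real.pi / 2) then (1 : ℝ) else 0) *
      (max (-φ (N k x) x) 1)⁻¹) * d (N k x) x) _
      (fun k => hL.dominated_mul ((Measurable.ite hbot_m measurable_const measurable_const).mul
        ((hφN k).neg.max measurable_const).inv)
        (fun x => mul_nonneg (by split_ifs <;> norm_num) (by positivity)) (hdN k)) ?_
    filter_upwards [hYN] with x hx
    by_cases h : ℓ x = -(Real.pi / 2)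
    · simp only [h, if_true, one_mul, hd]
      have h0 := tendsto_neg_atBot_atTop.comp (hbot x h)
      have h1 := tendsto_inv_atTop_zero.comp h0
      have h2 := (h1.mul hx).add_const (ξ x)
      rw [zero_mul, zero_add] at h2
      refine h2.congr' ?_
      filter_upwards [h0.eventually_ge_atTop 1] with k hk
      simp only [Function.comp_apply] at hk
      simp only [Function.comp_apply, max_eq_left hk]
      have : φ (N k x) x ≠ 0 := by linarith
      field_simp
      ring
    · simp [h]
  set e : X → ℝ := fun x => (if ℓ x = -(Real.pi / 2) then (1 : ℝ) else 0) -
    (if ℓ x = Real.pi / 2 then (1 : ℝ) else 0) with he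
  have hem : Measurable[m] e := (Measurable.ite hbot_m measurable_const measurable_const).sub
    (Measurable.ite htop_m measurable_const measurable_const)
  -- Dividing by the diverging coefficients has shown `e * ξ ≤ l₁` with `l₁ ∈ L`. The difference `l₁
  -- - e * ξ` is a nonnegative element of the enlarged module, so no arbitrage turns this into an
  -- equality.
  obtain ⟨l₁, hl₁, hl₁e⟩ := hL.dominated_add hneg hpos
  have heξ : ∀ᵐ x ∂μ, e x * ξ x = l₁ x := by
    have := hNA (fun x => l₁ x + (-e x) * ξ x) ⟨l₁, hl₁, fun x => -e x, hem.neg, rfl⟩ (by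
      filter_upwards [hl₁e] with x hx
      simp only [he]; linarith)
    filter_upwards [this] with x hx
    linarith
  -- Where `e ≠ 0` one has `ξ = e * l₁`, so `ξ` can be traded within `L` and the original sequence,
  -- without normalisation, is already dominated by `L`.
  have hdiv : (fun x => (e x * e x) * Z x) ∈ dominated μ L := by
    refine hcl (fun n x => (e x * e x) * Y n x) _ (fun n => ?_) ?_
    · refine ⟨_, hL.add_mem (hL.mul_mem (hem.mul hem) (hl n))
        (hL.mul_mem (hem.mul (hφ n)) hl₁), ?_⟩
      filter_upwards [hYw n, heξ] with x hx hx'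
      rw [hw'] at hx
      have h1 := mul_le_mul_of_nonneg_left hx (mul_self_nonneg (e x))
      have h2 : e x * e x * (l n x + φ n x * ξ x) =
        e x * e x * l n x + e x * φ n x * (e x * ξ x) := by ring
      rw [h2, hx'] at h1
      exact h1
    · filter_upwards [hYZ] with x hx using hx.const_mul _
  obtain ⟨l₂, hl₂, hl₂Z⟩ := hL.dominated_add hmid hdiv
  refine ⟨_, ⟨l₂, hl₂, fun x => (if |ℓ x| < Real.pi / 2 then (1 : ℝ) else 0) * Real.tan (ℓ x),
    (Measurable.ite hmid_m measurable_const measurable_const).mul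
      (by simp only [Real.tan_eq_sin_div_cos]
          exact (Real.measurable_sin.comp hℓ).div (Real.measurable_cos.comp hℓ)), rfl⟩, ?_⟩
  filter_upwards [hl₂Z] with x hx
  have hone : (if |ℓ x| < Real.pi / 2 then (1 : ℝ) else 0) + e x * e x = 1 := by
    rcases (hℓB x).lt_or_eq with h | h
    · have h1 : ℓ x ≠ Real.pi / 2 := fun h' => by
        rw [h', abs_of_pos (by positivity)] at h; exact lt_irrefl _ h
      have h2 : ℓ x ≠ -(Real.pi / 2) := fun h' => by
        rw [h', abs_neg, abs_of_pos (by positivity)] at h; exact lt_irrefl _ h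
      simp [he, h, h1, h2]
    · rcases (abs_eq (by positivity)).1 h with h' | h'
      · have h2 : ¬ (Real.pi / 2 = -(Real.pi / 2)) := by linarith
        simp [he, h', h2, abs_of_pos (show (0 : ℝ) < Real.pi / 2 by positivity)]
      · have h2 : ¬ (-(Real.pi / 2) = Real.pi / 2) := by linarith
        simp [he, h', h2, abs_of_pos (show (0 : ℝ) < Real.pi / 2 by positivity)]
  calc Z x = ((if |ℓ x| < Real.pi / 2 then (1 : ℝ) else 0) + e x * e x) * Z x := by
        rw [hone, one_mul]
    _ ≤ _ := by linarith

variable {ι : Type*}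

/-- The combinations `∑ i ∈ s, φ i * ξ i` whose coefficients are measurable for given
σ-algebras. -/
def combinations (𝔪 : ι → MeasurableSpace X) (ξ : ι → X → ℝ) (s : Finset ι) : Set (X → ℝ) :=
  {Y | ∃ φ : ι → X → ℝ, (∀ i, Measurable[𝔪 i] (φ i)) ∧ Y = fun x => ∑ i ∈ s, φ i x * ξ i x}

theorem isModuleOver_combinations {𝔪 : ι → MeasurableSpace X} {ξ : ι → X → ℝ} {s : Finset ι}
    (hm : ∀ i ∈ s, m ≤ 𝔪 i) : IsModuleOver m (combinations 𝔪 ξ s) where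
  zero_mem := ⟨fun _ _ => 0, fun _ => measurable_const, by simp⟩
  add_mem := by
    rintro _ _ ⟨φ, hφ, rfl⟩ ⟨ψ, hψ, rfl⟩
    refine ⟨fun i x => φ i x + ψ i x, fun i => (hφ i).add (hψ i), ?_⟩
    ext x
    simp [add_mul, Finset.sum_add_distrib]
  mul_mem := by
    classical
    rintro χ _ hχ ⟨φ, hφ, rfl⟩
    -- Outside `s` the factor `χ` need not be `𝔪 i`-measurable, so those irrelevant coefficients are
    -- left alone.
    refine ⟨fun i => if i ∈ s then fun x => χ x * φ i x else φ i, fun i => ?_, ?_⟩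
    · dsimp only
      split_ifs with h
      · exact (hχ.mono (hm i h) le_rfl).mul (hφ i)
      · exact hφ i
    · ext x
      rw [Finset.mul_sum]
      refine Finset.sum_congr rfl fun i hi => ?_
      simp [hi, mul_assoc]

theorem combinations_insert [DecidableEq ι] {𝔪 : ι → MeasurableSpace X} {ξ : ι → X → ℝ}
    {s : Finset ι} {a : ι} (ha : a ∉ s) :
    combinations 𝔪 ξ (insert a s) = adjoin (𝔪 a) (combinations 𝔪 ξ s) (ξ a) := by
  ext Y
  constructor
  · rintro ⟨φ, hφ, rfl⟩
    refine ⟨_, ⟨φ, hφ, rfl⟩, φ a, hφ a, ?_⟩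
    ext x
    rw [Finset.sum_insert ha, add_comm]
  · rintro ⟨_, ⟨φ, hφ, rfl⟩, ψ, hψ, rfl⟩
    refine ⟨Function.update φ a ψ, fun i => ?_, ?_⟩
    · rcases eq_or_ne i a with rfl | h
      · simpa using hψ
      · simpa [h] using hφ i
    · ext x
      rw [Finset.sum_insert ha, add_comm, Function.update_self]
      congr 1
      refine Finset.sum_congr rfl fun i hi => ?_
      rw [Function.update_of_ne (ne_of_mem_of_not_mem hi ha)]

/-- The cone dominated by the combinations with coefficients measurable for a monotone family of
σ-algebras is closed, if there is no arbitrage. -/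
theorem aeclosed_dominated_combinations {α : Type*} [LinearOrder α] (τ : ι → α)
    {𝔪 : ι → MeasurableSpace X} (h𝔪 : ∀ i j, τ i ≤ τ j → 𝔪 i ≤ 𝔪 j) {ξ : ι → X → ℝ}
    (s : Finset ι) (hNA : ArbitrageFree μ (combinations 𝔪 ξ s)) :
    AEClosed μ (dominated μ (combinations 𝔪 ξ s)) := by
  classical
  -- The generator adjoined last has the earliest date. The later ones then form a module over its
  -- σ-algebra, as `aeclosed_adjoin` requires.
  induction s using Finset.induction_on_min_value τ with
  | empty =>
    intro Y Z hY hYZ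
    refine ⟨_, ⟨fun _ _ => 0, fun _ => measurable_const, rfl⟩, ?_⟩
    choose l hl hYl using hY
    filter_upwards [ae_all_iff.2 hYl, hYZ] with x hx hx'
    refine le_of_tendsto' hx' fun n => ?_
    obtain ⟨φ, -, h⟩ := hl n
    simpa [h] using hx n
  | insert a s ha hmin ih =>
    have hmod : IsModuleOver (𝔪 a) (combinations 𝔪 ξ s) :=
      isModuleOver_combinations fun i hi => h𝔪 _ _ (hmin i hi)
    rw [combinations_insert ha] at hNA ⊢
    refine hmod.aeclosed_adjoin (ih fun l hl => hNA l ?_) hNA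
    exact ⟨l, hl, fun _ => 0, measurable_const, by simp⟩

end Closedness

/-! ### Forward convex combinations and limits of exercise strategies. -/

section ConvexCombinations

/-- Weights of a sequence of forward convex combinations: the `n`-th weights are carried by the
indices `m ≥ n`. -/
structure IsForwardWeights (w : ℕ → ℕ →₀ ℝ) : Prop where
  nonneg : ∀ n m, 0 ≤ w n m
  forward : ∀ n m, m < n → w n m = 0
  sum_eq_one : ∀ n, ∑ m ∈ (w n).support, w n m = 1

theorem IsForwardWeights.comp {w : ℕ → ℕ →₀ ℝ} (hw : IsForwardWeights w) {φ : ℕ → ℕ}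
    (hφ : StrictMono φ) : IsForwardWeights (fun n => w (φ n)) where
  nonneg _ m := hw.nonneg _ m
  forward _ m h := hw.forward _ m (h.trans_le hφ.le_apply)
  sum_eq_one _ := hw.sum_eq_one _

theorem IsForwardWeights.tendsto {w : ℕ → ℕ →₀ ℝ} (hw : IsForwardWeights w) {u : ℕ → ℝ} {a : ℝ}
    (hu : Tendsto u atTop (𝓝 a)) :
    Tendsto (fun n => ∑ m ∈ (w n).support, w n m * u m) atTop (𝓝 a) := by
  rw [Metric.tendsto_atTop] at hu ⊢
  intro ε hε
  obtain ⟨N, hN⟩ := hu (ε / 2) (by positivity)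
  refine ⟨N, fun n hn => ?_⟩
  have h1 : (∑ m ∈ (w n).support, w n m * u m) - a =
      ∑ m ∈ (w n).support, w n m * (u m - a) := by
    simp only [mul_sub, Finset.sum_sub_distrib, ← Finset.sum_mul, hw.sum_eq_one, one_mul]
  rw [Real.dist_eq, h1]
  calc |∑ m ∈ (w n).support, w n m * (u m - a)|
      ≤ ∑ m ∈ (w n).support, |w n m * (u m - a)| := Finset.abs_sum_le_sum_abs _ _
    _ ≤ ∑ m ∈ (w n).support, w n m * (ε / 2) := by
        refine Finset.sum_le_sum fun m hm => ?_
        rw [abs_mul, abs_of_nonneg (hw.nonneg n m)]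
        refine mul_le_mul_of_nonneg_left ?_ (hw.nonneg n m)
        have hmn : n ≤ m := by
          by_contra h
          exact (Finsupp.mem_support_iff.1 hm) (hw.forward n m (not_le.1 h))
        have := hN m (hn.trans hmn)
        rw [Real.dist_eq] at this
        exact this.le
    _ = ε / 2 := by rw [← Finset.sum_mul, hw.sum_eq_one, one_mul]
    _ < ε := by linarith

/-- A bounded sequence of a Hilbert space has convergent forward convex combinations. -/
theorem exists_forwardWeights_tendsto {H : Type*} [NormedAddCommGroup H] [InnerProductSpace ℝ H]
    [CompleteSpace H] {x : ℕ → H} {B : ℝ} (hB : ∀ n, ‖x n‖ ≤ B) :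
    ∃ w : ℕ → ℕ →₀ ℝ, IsForwardWeights w ∧
      ∃ y, Tendsto (fun n => ∑ m ∈ (w n).support, w n m • x m) atTop (𝓝 y) := by
  classical
  -- `P n` is the set of convex weights carried by the tail from `n` on. Almost norm-minimal
  -- combinations of the tails form a Cauchy sequence.
  let P : ℕ → Set (ℕ →₀ ℝ) := fun n =>
    {v | (∀ m, 0 ≤ v m) ∧ (∀ m, m < n → v m = 0) ∧
      Finsupp.linearCombination ℝ (fun _ : ℕ => (1 : ℝ)) v = 1}
  let S : (ℕ →₀ ℝ) →ₗ[ℝ] H := Finsupp.linearCombination ℝ x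
  have hPmono : ∀ {n m}, n ≤ m → P m ⊆ P n := fun h v hv =>
    ⟨hv.1, fun k hk => hv.2.1 k (hk.trans_le h), hv.2.2⟩
  have hPmid : ∀ n, ∀ v ∈ P n, ∀ v' ∈ P n, (1 / 2 : ℝ) • (v + v') ∈ P n := by
    intro n v hv v' hv'
    refine ⟨fun m => ?_, fun m hm => ?_, ?_⟩
    · have := hv.1 m
      have := hv'.1 m
      simp only [Finsupp.smul_apply, Finsupp.add_apply, smul_eq_mul]
      positivity
    · simp [hv.2.1 m hm, hv'.2.1 m hm]
    · rw [map_smul, map_add, hv.2.2, hv'.2.2]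
      norm_num
  have hPne : ∀ n, Finsupp.single n 1 ∈ P n := by
    intro n
    refine ⟨fun m => ?_, fun m hm => ?_, by simp⟩
    · rw [Finsupp.single_apply]; split_ifs <;> norm_num
    · simp [hm.ne']
  let D : ℕ → ℝ := fun n => sInf ((fun v => ‖S v‖) '' P n)
  have hbdd : ∀ n, BddBelow ((fun v => ‖S v‖) '' P n) := fun n =>
    ⟨0, by rintro _ ⟨v, -, rfl⟩; exact norm_nonneg _⟩
  have hD0 : ∀ n, 0 ≤ D n := fun n => Real.sInf_nonneg (by
    rintro _ ⟨v, -, rfl⟩; exact norm_nonneg _)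
  have hDle : ∀ n, ∀ v ∈ P n, D n ≤ ‖S v‖ := fun n v hv => csInf_le (hbdd n) ⟨v, hv, rfl⟩
  have hDmono : Monotone D := fun n m h =>
    csInf_le_csInf (hbdd n) ⟨_, _, hPne m, rfl⟩ (Set.image_mono (hPmono h))
  have hDB : ∀ n, D n ≤ B := fun n => (hDle n _ (hPne n)).trans (by simpa [S] using hB n)
  have hconv : Tendsto D atTop (𝓝 (⨆ n, D n)) :=
    tendsto_atTop_ciSup hDmono ⟨B, by rintro _ ⟨n, rfl⟩; exact hDB n⟩
  have hex : ∀ n : ℕ, ∃ v ∈ P n, ‖S v‖ < D n + 1 / ((n : ℝ) + 1) := by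
    intro n
    obtain ⟨_, ⟨v, hv, rfl⟩, h⟩ := exists_lt_of_csInf_lt
      (⟨_, _, hPne n, rfl⟩ : ((fun v => ‖S v‖) '' P n).Nonempty)
      (show D n < D n + 1 / ((n : ℝ) + 1) by have : (0 : ℝ) < 1 / ((n : ℝ) + 1) := by positivity
                                             linarith)
    exact ⟨v, hv, h⟩
  choose w hwP hwn using hex
  refine ⟨w, ⟨fun n => (hwP n).1, fun n => (hwP n).2.1, fun n => ?_⟩, ?_⟩
  · have := (hwP n).2.2
    simpa [Finsupp.linearCombination_apply, Finsupp.sum] using this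
  -- Parallelogram law: the midpoint of `w n` and `w m` still lies in `P n`, so its image has norm
  -- at least `D n`.
  have key : ∀ n m, n ≤ m → ‖S (w n) - S (w m)‖ ^ 2 ≤
      2 * (D n + 1 / ((n : ℝ) + 1)) ^ 2 + 2 * (D m + 1 / ((m : ℝ) + 1)) ^ 2 - 4 * D n ^ 2 := by
    intro n m hnm
    have h1 := parallelogram_law_with_norm ℝ (S (w n)) (S (w m))
    have h2 := hDle n _ (hPmid n _ (hwP n) _ (hPmono hnm (hwP m)))
    rw [map_smul, map_add, norm_smul] at h2
    have h3 : 4 * D n ^ 2 ≤ ‖S (w n) + S (w m)‖ ^ 2 := by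
      have h4 : 2 * D n ≤ ‖S (w n) + S (w m)‖ := by
        norm_num at h2
        linarith
      calc 4 * D n ^ 2 = (2 * D n) ^ 2 := by ring
        _ ≤ _ := pow_le_pow_left₀ (by linarith [hD0 n]) h4 2
    have h5 := pow_le_pow_left₀ (norm_nonneg _) (hwn n).le 2
    have h6 := pow_le_pow_left₀ (norm_nonneg _) (hwn m).le 2
    nlinarith
  have hcauchy : CauchySeq (fun n => S (w n)) := by
    rw [Metric.cauchySeq_iff']
    intro ε hε
    set d := ⨆ n, D n with hd
    have hzero := tendsto_one_div_add_atTop_nhds_zero_nat (𝕜 := ℝ)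
    have hA : Tendsto (fun n : ℕ => (D n + 1 / ((n : ℝ) + 1)) ^ 2) atTop (𝓝 (d ^ 2)) := by
      simpa using (hconv.add hzero).pow 2
    have hC : Tendsto (fun n : ℕ => D n ^ 2) atTop (𝓝 (d ^ 2)) := hconv.pow 2
    have e1 := hA.eventually (eventually_lt_nhds
      (show d ^ 2 < d ^ 2 + ε ^ 2 / 16 by have := pow_pos hε 2; linarith))
    have e2 := hC.eventually (eventually_gt_nhds
      (show d ^ 2 - ε ^ 2 / 16 < d ^ 2 by have := pow_pos hε 2; linarith))
    obtain ⟨N, hN⟩ := eventually_atTop.1 (e1.and e2)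
    refine ⟨N, fun m hm => ?_⟩
    rw [dist_comm, dist_eq_norm]
    have h := key N m hm
    have h1 := hN N le_rfl
    have h2 := hN m hm
    have : ‖S (w N) - S (w m)‖ ^ 2 < ε ^ 2 := by
      have := pow_pos hε 2
      linarith [h1.1, h1.2, h2.1]
    exact lt_of_pow_lt_pow_left₀ 2 hε.le this
  obtain ⟨y, hy⟩ := cauchySeq_tendsto_of_complete hcauchy
  refine ⟨y, hy.congr fun n => ?_⟩
  simp [S, Finsupp.linearCombination_apply, Finsupp.sum]

variable {X : Type*} {mX : MeasurableSpace X} {μ : Measure X}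

/-- Uniformly bounded sequences of measurable functions, finitely many, have common forward convex
combinations that converge almost everywhere. -/
theorem exists_forwardWeights_ae_tendsto [IsFiniteMeasure μ] {J : Type*} [Fintype J]
    {z : ℕ → J → X → ℝ} (hz : ∀ n j, Measurable (z n j)) {B : ℝ} (hB : ∀ n j x, |z n j x| ≤ B) :
    ∃ w : ℕ → ℕ →₀ ℝ, IsForwardWeights w ∧ ∀ᵐ x ∂μ, ∀ j, ∃ a,
      Tendsto (fun n => ∑ m ∈ (w n).support, w n m * z m j x) atTop (𝓝 a) := by
  let F : ℕ → X → EuclideanSpace ℝ J := fun n x => WithLp.toLp 2 (fun j => z n j x)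
  have hFm : ∀ n, Measurable (F n) := fun n =>
    (WithLp.measurable_toLp 2 (J → ℝ)).comp (measurable_pi_lambda _ fun j => hz n j)
  have hFB : ∀ n x, ‖F n x‖ ≤ √(∑ _j : J, B ^ 2) := by
    intro n x
    rw [EuclideanSpace.norm_eq]
    refine Real.sqrt_le_sqrt (Finset.sum_le_sum fun j _ => ?_)
    exact pow_le_pow_left₀ (norm_nonneg _) (hB n j x) 2
  have hFL : ∀ n, MemLp (F n) 2 μ := fun n =>
    MemLp.of_bound (hFm n).aestronglyMeasurable _ (ae_of_all _ (hFB n))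
  obtain ⟨w, hw, y, hy⟩ := exists_forwardWeights_tendsto (x := fun n => (hFL n).toLp (F n))
    (B := (measureUnivNNReal μ : ℝ) ^ (ENNReal.toReal 2)⁻¹ * √(∑ _j : J, B ^ 2)) (fun n => by
      refine Lp.norm_le_of_ae_bound (Real.sqrt_nonneg _) ?_
      filter_upwards [(hFL n).coeFn_toLp] with x hx
      rw [hx]
      exact hFB n x)
  -- Convergence in `L²` becomes a.e. convergence along a subsequence, and forward weights stay
  -- forward when thinned out.
  obtain ⟨φ, hφ, hφy⟩ := (tendstoInMeasure_of_tendsto_Lp hy).exists_seq_tendsto_ae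
  refine ⟨_, hw.comp hφ, ?_⟩
  have hsum : ∀ n, ⇑(∑ m ∈ (w n).support, w n m • (hFL m).toLp (F m)) =ᵐ[μ]
      fun x => ∑ m ∈ (w n).support, w n m • F m x := by
    intro n
    refine (Lp.coeFn_finsetSum _ _).trans ?_
    have h1 : ∀ᵐ x ∂μ, ∀ m, (w n m • (hFL m).toLp (F m) : Lp _ 2 μ) x = w n m • F m x :=
      ae_all_iff.2 fun m => by
        filter_upwards [Lp.coeFn_smul (w n m) ((hFL m).toLp (F m)), (hFL m).coeFn_toLp] with x h h'
        rw [h, Pi.smul_apply, h']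
    filter_upwards [h1] with x hx
    simp [hx]
  filter_upwards [hφy, ae_all_iff.2 hsum] with x hx hx' j
  refine ⟨y x j, ?_⟩
  have h2 := ((EuclideanSpace.proj j : EuclideanSpace ℝ J →L[ℝ] ℝ).continuous.tendsto _).comp hx
  refine h2.congr fun n => ?_
  rw [Function.comp_apply, hx']
  simp [F]

/-- Exercise strategies of total weight `b`: nonnegative adapted processes with sum `b`. -/
structure IsExercise {T : ℕ} (𝔾 : Filtration (Fin (T + 1)) mX) (b : ℝ)
    (η : Fin (T + 1) → X → ℝ) : Prop where
  measurable : ∀ t, Measurable[𝔾 t] (η t)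
  nonneg : ∀ t x, 0 ≤ η t x
  sum_eq : ∀ x, ∑ t, η t x = b

/-- An almost everywhere convergent sequence of exercise strategies has an exercise strategy as
limit. -/
theorem exists_isExercise_limit {T : ℕ} {𝔾 : Filtration (Fin (T + 1)) mX} {b : ℕ → ℝ} {b₀ : ℝ}
    (hb : Tendsto b atTop (𝓝 b₀)) {η : ℕ → Fin (T + 1) → X → ℝ}
    (hη : ∀ n, IsExercise 𝔾 (b n) (η n))
    (hconv : ∀ᵐ x ∂μ, ∀ t, ∃ a, Tendsto (fun n => η n t x) atTop (𝓝 a)) :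
    ∃ η₀, IsExercise 𝔾 b₀ η₀ ∧ ∀ᵐ x ∂μ, ∀ t, Tendsto (fun n => η n t x) atTop (𝓝 (η₀ t x)) := by
  -- The limit must be adapted, nonnegative and of total `b₀` at every point, also where the
  -- sequence diverges. Upper limits of the cumulative sums are monotone in `k`, run from `0` to
  -- `b₀`, and have adapted increments; upper limits of the `η n t` themselves need not add up to
  -- `b₀`.
  let Λ : ℕ → ℕ → X → ℝ := fun n k x => ∑ t : Fin (T + 1) with t.val < k, η n t x
  let A : ℕ → X → ℝ := fun k x => limsup (fun n => Λ n k x) atTop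
  have hΛ0 : ∀ n k x, 0 ≤ Λ n k x := fun n k x => Finset.sum_nonneg fun t _ => (hη n).nonneg t x
  have hΛmono : ∀ n k x, Λ n k x ≤ Λ n (k + 1) x := fun n k x =>
    Finset.sum_le_sum_of_subset_of_nonneg
      (fun t => by simp only [Finset.mem_filter_univ]; omega) fun t _ _ => (hη n).nonneg t x
  have hΛb : ∀ n k x, Λ n k x ≤ b n := fun n k x => by
    rw [← (hη n).sum_eq x]
    exact Finset.sum_le_sum_of_subset_of_nonneg (Finset.filter_subset _ _)
      fun t _ _ => (hη n).nonneg t x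
  have hstep : ∀ n (t : Fin (T + 1)) x, Λ n (t + 1) x - Λ n t x = η n t x := by
    intro n t x
    have : (Finset.univ.filter fun s : Fin (T + 1) => s.val < t.val + 1) =
        insert t (Finset.univ.filter fun s : Fin (T + 1) => s.val < t.val) := by
      ext s
      simp only [Finset.mem_filter_univ, Finset.mem_insert, Fin.ext_iff]
      omega
    simp only [Λ]
    rw [this, Finset.sum_insert (by simp)]
    ring
  have hbd : ∀ k x, IsBoundedUnder (· ≤ ·) atTop (fun n => Λ n k x) := fun k x =>
    hb.isBoundedUnder_le.mono_le (Eventually.of_forall fun n => hΛb n k x)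
  have hbd' : ∀ k x, IsCoboundedUnder (· ≤ ·) atTop (fun n => Λ n k x) := fun k x =>
    (isBoundedUnder_of ⟨0, fun n => hΛ0 n k x⟩ :
      IsBoundedUnder (· ≥ ·) atTop (fun n => Λ n k x)).isCoboundedUnder_le
  have hAm : ∀ (t : Fin (T + 1)) (k : ℕ), k ≤ t + 1 → Measurable[𝔾 t] (A k) := by
    intro t k hk
    refine Measurable.limsup fun n => ?_
    refine Finset.measurable_sum _ fun s hs => ?_
    refine ((hη n).measurable s).mono (𝔾.mono ?_) le_rfl
    rw [Finset.mem_filter_univ] at hs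
    rw [Fin.le_def]
    omega
  refine ⟨fun t x => A (t + 1) x - A t x, ⟨fun t => ?_, fun t x => ?_, fun x => ?_⟩, ?_⟩
  · exact (hAm t _ le_rfl).sub (hAm t _ (Nat.le_succ _))
  · exact sub_nonneg.2 (limsup_le_limsup (Eventually.of_forall fun n => hΛmono n t x)
      (hbd' _ x) (hbd _ x))
  · rw [Fin.sum_univ_eq_sum_range (fun k => A (k + 1) x - A k x), Finset.sum_range_sub (fun k => A k x)]
    have h0 : A 0 x = 0 := by simp [A, Λ]
    have h1 : A (T + 1) x = b₀ := by
      have : ∀ n, Λ n (T + 1) x = b n := fun n => by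
        rw [← (hη n).sum_eq x]
        exact Finset.sum_congr (Finset.filter_true_of_mem fun t _ => t.2) fun _ _ => rfl
      simp only [A, this]
      exact hb.limsup_eq
    rw [h0, h1, sub_zero]
  · filter_upwards [hconv] with x hx t
    have hΛconv : ∀ k, Tendsto (fun n => Λ n k x) atTop (𝓝 (A k x)) := by
      intro k
      choose a ha using hx
      have h := tendsto_finsetSum (Finset.univ.filter fun t : Fin (T + 1) => t.val < k)
        fun t _ => ha t
      have : A k x = _ := h.limsup_eq
      rw [this]
      exact h
    refine ((hΛconv (t + 1)).sub (hΛconv t)).congr fun n => hstep n t x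

end ConvexCombinations

/-! ### Closedness of the cone of superreplicable claims. -/

section ClaimCone

variable {X : Type*} {mX : MeasurableSpace X} {μ : Measure X}

theorem IsModuleOver.sum_smul_mem {m : MeasurableSpace X} {L : Set (X → ℝ)}
    (hL : IsModuleOver m L) {ι : Type*} (s : Finset ι) (c : ι → ℝ) {l : ι → X → ℝ}
    (hl : ∀ i, l i ∈ L) : (fun x => ∑ i ∈ s, c i * l i x) ∈ L := by
  classical
  induction s using Finset.induction_on with
  | empty => simpa using hL.zero_mem
  | insert i s hi ih =>
    simp only [Finset.sum_insert hi]
    exact hL.add_mem (hL.mul_mem (φ := fun _ => c i) measurable_const (hl i)) ih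

variable {T : ℕ} {𝔾 : Filtration (Fin (T + 1)) mX} {ι κ : Type*} [Fintype ι] [Fintype κ]

/-- The payoff of the positions `a` in the claims `e`, and of the exercise strategies `η` for the
American claims `g`. -/
def optionPayoff (e : ι → X → ℝ) (g : κ → Fin (T + 1) → X → ℝ) (a : ι → ℝ)
    (η : κ → Fin (T + 1) → X → ℝ) (x : X) : ℝ :=
  ∑ i, a i * e i x + ∑ j, ∑ t, g j t x * η j t x

theorem optionPayoff_sum (e : ι → X → ℝ) (g : κ → Fin (T + 1) → X → ℝ) {J : Type*} (s : Finset J)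
    (c : J → ℝ) (a : J → ι → ℝ) (η : J → κ → Fin (T + 1) → X → ℝ) (x : X) :
    optionPayoff e g (fun i => ∑ m ∈ s, c m * a m i) (fun j t x => ∑ m ∈ s, c m * η m j t x) x =
      ∑ m ∈ s, c m * optionPayoff e g (a m) (η m) x := by
  simp only [optionPayoff, mul_add, Finset.sum_add_distrib, Finset.mul_sum, Finset.sum_mul]
  congr 1
  · rw [Finset.sum_comm]
    simp only [mul_assoc]
  · symm
    rw [Finset.sum_comm]
    refine Finset.sum_congr rfl fun j _ => ?_
    rw [Finset.sum_comm]
    refine Finset.sum_congr rfl fun t _ => Finset.sum_congr rfl fun m _ => ?_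
    ring

/-- The claims that can be superreplicated by an element of `L` and positions in options. -/
def claimCone (μ : Measure X) (𝔾 : Filtration (Fin (T + 1)) mX) (L : Set (X → ℝ))
    (e : ι → X → ℝ) (g : κ → Fin (T + 1) → X → ℝ) : Set (X → ℝ) :=
  {Y | ∃ l ∈ L, ∃ (a : ι → ℝ) (b : κ → ℝ) (η : κ → Fin (T + 1) → X → ℝ), (∀ i, 0 ≤ a i) ∧
    (∀ j, IsExercise 𝔾 (b j) (η j)) ∧ ∀ᵐ x ∂μ, Y x ≤ l x + optionPayoff e g a η x}

/-- Every position in options exposes to a risk of loss, whatever the element of `L` it is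
combined with. -/
def OptionsAtRisk (μ : Measure X) (𝔾 : Filtration (Fin (T + 1)) mX) (L : Set (X → ℝ))
    (e : ι → X → ℝ) (g : κ → Fin (T + 1) → X → ℝ) : Prop :=
  ∀ l ∈ L, ∀ (a : ι → ℝ) (b : κ → ℝ) (η : κ → Fin (T + 1) → X → ℝ), (∀ i, 0 ≤ a i) →
    (∀ j, IsExercise 𝔾 (b j) (η j)) → (∀ᵐ x ∂μ, 0 ≤ l x + optionPayoff e g a η x) →
    (∀ i, a i = 0) ∧ ∀ j, b j = 0

theorem IsExercise.smul {b c : ℝ} {η : Fin (T + 1) → X → ℝ} (h : IsExercise 𝔾 b η) (hc : 0 ≤ c) :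
    IsExercise 𝔾 (c * b) (fun t x => c * η t x) where
  measurable t := (h.measurable t).const_mul c
  nonneg t x := mul_nonneg hc (h.nonneg t x)
  sum_eq x := by rw [← Finset.mul_sum, h.sum_eq]

theorem IsExercise.sum {J : Type*} (s : Finset J) {b : J → ℝ} {η : J → Fin (T + 1) → X → ℝ}
    (h : ∀ m, IsExercise 𝔾 (b m) (η m)) :
    IsExercise 𝔾 (∑ m ∈ s, b m) (fun t x => ∑ m ∈ s, η m t x) where
  measurable t := Finset.measurable_sum _ fun m _ => (h m).measurable t
  nonneg t x := Finset.sum_nonneg fun m _ => (h m).nonneg t x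
  sum_eq x := by
    rw [Finset.sum_comm]
    exact Finset.sum_congr rfl fun m _ => (h m).sum_eq x

theorem IsExercise.le {b : ℝ} {η : Fin (T + 1) → X → ℝ} (h : IsExercise 𝔾 b η) (t x) :
    η t x ≤ b := by
  rw [← h.sum_eq x]
  exact Finset.single_le_sum (fun t _ => h.nonneg t x) (Finset.mem_univ t)

/-- The cone of superreplicable claims is closed under almost everywhere convergence. -/
theorem aeclosed_claimCone [IsFiniteMeasure μ] [NeZero μ] {L : Set (X → ℝ)}
    {m₀ : MeasurableSpace X} (hL : IsModuleOver m₀ L) (hcl : AEClosed μ (dominated μ L))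
    {e : ι → X → ℝ} {g : κ → Fin (T + 1) → X → ℝ} (hrisk : OptionsAtRisk μ 𝔾 L e g) :
    AEClosed μ (claimCone μ 𝔾 L e g) := by
  intro Y Z hY hYZ
  choose l hl a b η ha hη hle using hY
  -- A point is needed because `b n j` is known to be nonnegative only as a sum of exercise weights
  -- at some point.
  obtain ⟨x₁⟩ : Nonempty X := (ae_neBot.2 (NeZero.ne μ)).nonempty
  have hb0 : ∀ n j, 0 ≤ b n j := fun n j => by
    rw [← (hη n j).sum_eq x₁]
    exact Finset.sum_nonneg fun t _ => (hη n j).nonneg t x₁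
  -- Dividing by `r n` makes `1`, `a n` and `b n` together of total mass `1`. This mass survives
  -- convex combinations and limits, see `htotal`; the limit `ρ` of the first share tells whether
  -- positions blow up.
  let r : ℕ → ℝ := fun n => 1 + ∑ i, a n i + ∑ j, b n j
  have hsa : ∀ n, 0 ≤ ∑ i, a n i := fun n => Finset.sum_nonneg fun i _ => ha n i
  have hsb : ∀ n, 0 ≤ ∑ j, b n j := fun n => Finset.sum_nonneg fun j _ => hb0 n j
  have hr1 : ∀ n, 1 ≤ r n := fun n => by simp only [r]; linarith [hsa n, hsb n]
  have hr0 : ∀ n, 0 < r n := fun n => one_pos.trans_le (hr1 n)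
  have har : ∀ n i, a n i ≤ r n := fun n i => by
    have := Finset.single_le_sum (fun i _ => ha n i) (Finset.mem_univ i)
    simp only [r]; linarith [hsb n]
  have hbr : ∀ n j, b n j ≤ r n := fun n j => by
    have := Finset.single_le_sum (fun j _ => hb0 n j) (Finset.mem_univ j)
    simp only [r]; linarith [hsa n]
  let z : ℕ → Unit ⊕ ι ⊕ (κ × Fin (T + 1)) → X → ℝ := fun n =>
    Sum.elim (fun _ _ => (r n)⁻¹ * 1)
      (Sum.elim (fun i _ => (r n)⁻¹ * a n i) (fun p x => (r n)⁻¹ * η n p.1 p.2 x))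
  have hunit : ∀ n c, 0 ≤ c → c ≤ r n → |(r n)⁻¹ * c| ≤ 1 := fun n c h0 h1 => by
    rw [abs_of_nonneg (mul_nonneg (inv_nonneg.2 (hr0 n).le) h0), inv_mul_le_iff₀ (hr0 n), mul_one]
    exact h1
  obtain ⟨w, hw, hconv⟩ := exists_forwardWeights_ae_tendsto (μ := μ) (z := z) (B := 1)
    (by
      rintro n (_ | i | ⟨j, t⟩)
      · exact measurable_const
      · exact measurable_const
      · exact (((hη n j).measurable t).mono (𝔾.le t) le_rfl).const_mul _)
    (by
      rintro n (_ | i | ⟨j, t⟩) x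
      · exact hunit n 1 zero_le_one (hr1 n)
      · exact hunit n _ (ha n i) (har n i)
      · exact hunit n _ ((hη n j).nonneg t x) (((hη n j).le t x).trans (hbr n j)))
  obtain ⟨x₀, hx₀⟩ := hconv.exists
  obtain ⟨ρ, hρ⟩ := hx₀ (Sum.inl ())
  choose a₀ ha₀ using fun i => hx₀ (Sum.inr (Sum.inl i))
  choose c₀ hc₀ using fun p => hx₀ (Sum.inr (Sum.inr p))
  simp only [z, Sum.elim_inl, Sum.elim_inr, ← mul_assoc] at hρ ha₀ hc₀
  let v : ℕ → ℕ → ℝ := fun n m => w n m * (r m)⁻¹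
  have hv0 : ∀ n m, 0 ≤ v n m := fun n m => mul_nonneg (hw.nonneg n m) (inv_nonneg.2 (hr0 m).le)
  have hb₀ : ∀ j, Tendsto (fun n => ∑ m ∈ (w n).support, v n m * b m j) atTop
      (𝓝 (∑ t, c₀ (j, t))) := fun j => by
    refine (tendsto_finsetSum Finset.univ fun t _ => hc₀ (j, t)).congr fun n => ?_
    rw [Finset.sum_comm]
    refine Finset.sum_congr rfl fun m _ => ?_
    rw [← Finset.mul_sum, (hη m j).sum_eq]
  have hηn : ∀ n j, IsExercise 𝔾 (∑ m ∈ (w n).support, v n m * b m j)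
      (fun t x => ∑ m ∈ (w n).support, v n m * η m j t x) := fun n j =>
    IsExercise.sum _ fun m => (hη m j).smul (hv0 n m)
  choose η₀ hη₀ hηlim using fun j => exists_isExercise_limit (μ := μ) (hb₀ j)
    (fun n => hηn n j) (by
      filter_upwards [hconv] with x hx t
      obtain ⟨c, hc⟩ := hx (Sum.inr (Sum.inr (j, t)))
      refine ⟨c, hc.congr fun n => ?_⟩
      simp [z, v, mul_assoc])
  have ha₀0 : ∀ i, 0 ≤ a₀ i := fun i => ge_of_tendsto' (ha₀ i) fun n =>
    Finset.sum_nonneg fun m _ => mul_nonneg (hv0 n m) (ha m i)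
  have hρ0 : 0 ≤ ρ := ge_of_tendsto' hρ fun n =>
    Finset.sum_nonneg fun m _ => mul_nonneg (hv0 n m) zero_le_one
  have htotal : ρ + ∑ i, a₀ i + ∑ j, ∑ t, c₀ (j, t) = 1 := by
    refine tendsto_nhds_unique ((hρ.add (tendsto_finsetSum Finset.univ fun i _ => ha₀ i)).add
      (tendsto_finsetSum Finset.univ fun j _ => hb₀ j)) ?_
    refine tendsto_const_nhds.congr fun n => ?_
    rw [Finset.sum_comm, Finset.sum_comm (s := Finset.univ (α := κ)), ← Finset.sum_add_distrib,
      ← Finset.sum_add_distrib]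
    refine (hw.sum_eq_one n).symm.trans (Finset.sum_congr rfl fun m _ => ?_)
    simp only [v]
    rw [← Finset.mul_sum, ← Finset.mul_sum, ← mul_add, ← mul_add, mul_assoc]
    change _ = w n m * ((r m)⁻¹ * r m)
    rw [inv_mul_cancel₀ (hr0 m).ne', mul_one]
  have hYv : ∀ᵐ x ∂μ, Tendsto (fun n => ∑ m ∈ (w n).support, v n m * Y m x) atTop
      (𝓝 (ρ * Z x)) := by
    filter_upwards [hYZ] with x hx
    have h1 : Tendsto (fun m => (r m)⁻¹ * (Y m x - Z x)) atTop (𝓝 0) := by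
      refine squeeze_zero_norm (fun m => ?_) (tendsto_iff_norm_sub_tendsto_zero.1 hx)
      rw [norm_mul, Real.norm_of_nonneg (inv_nonneg.2 (hr0 m).le)]
      exact mul_le_of_le_one_left (norm_nonneg _) (inv_le_one_of_one_le₀ (hr1 m))
    have h2 := (hw.tendsto h1).add (hρ.mul_const (Z x))
    rw [zero_add] at h2
    refine h2.congr fun n => ?_
    rw [Finset.sum_mul, ← Finset.sum_add_distrib]
    refine Finset.sum_congr rfl fun m _ => ?_
    simp only [v]; ring
  have hdom : (fun x => ρ * Z x - optionPayoff e g a₀ η₀ x) ∈ dominated μ L := by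
    refine hcl (fun n x => (∑ m ∈ (w n).support, v n m * Y m x) - optionPayoff e g
      (fun i => ∑ m ∈ (w n).support, v n m * a m i)
      (fun j t x => ∑ m ∈ (w n).support, v n m * η m j t x) x) _ (fun n => ?_) ?_
    · refine ⟨_, hL.sum_smul_mem (w n).support (v n) hl, ?_⟩
      filter_upwards [ae_all_iff.2 hle] with x hx
      rw [optionPayoff_sum, sub_le_iff_le_add, ← Finset.sum_add_distrib]
      refine Finset.sum_le_sum fun m _ => ?_
      rw [← mul_add]
      exact mul_le_mul_of_nonneg_left (hx m) (hv0 n m)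
    · filter_upwards [hYv, ae_all_iff.2 hηlim] with x hx hx'
      refine hx.sub (Tendsto.add ?_ ?_)
      · exact tendsto_finsetSum _ fun i _ => (ha₀ i).mul_const _
      · exact tendsto_finsetSum _ fun j _ => tendsto_finsetSum _ fun t _ => (hx' j t).const_mul _
  obtain ⟨l₀, hl₀, hle₀⟩ := hdom
  -- With `ρ = 0` the limiting option position would be hedged without loss by `l₀`; the risk
  -- property makes it zero, against the total mass `1`.
  have hρpos : 0 < ρ := by
    refine hρ0.lt_of_ne' fun h => ?_
    obtain ⟨h1, h2⟩ := hrisk l₀ hl₀ a₀ _ η₀ ha₀0 hη₀ (by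
      filter_upwards [hle₀] with x hx
      rw [h, zero_mul] at hx
      linarith)
    simp [h, h1, h2] at htotal
  refine ⟨_, hL.mul_mem (φ := fun _ => ρ⁻¹) measurable_const hl₀, fun i => ρ⁻¹ * a₀ i, _,
    fun j t x => ρ⁻¹ * η₀ j t x, fun i => mul_nonneg (inv_nonneg.2 hρ0) (ha₀0 i),
    fun j => (hη₀ j).smul (inv_nonneg.2 hρ0), ?_⟩
  filter_upwards [hle₀] with x hx
  have h1 : optionPayoff e g (fun i => ρ⁻¹ * a₀ i) (fun j t x => ρ⁻¹ * η₀ j t x) x =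
      ρ⁻¹ * optionPayoff e g a₀ η₀ x := by
    simpa using optionPayoff_sum e g {()} (fun _ => ρ⁻¹) (fun _ => a₀) (fun _ => η₀) x
  rw [h1, ← mul_add, ← div_eq_inv_mul, le_div_iff₀ hρpos]
  linarith

theorem claimCone_add {m₀ : MeasurableSpace X} {L : Set (X → ℝ)} (hL : IsModuleOver m₀ L)
    {e : ι → X → ℝ} {g : κ → Fin (T + 1) → X → ℝ} {Y Z : X → ℝ} (hY : Y ∈ claimCone μ 𝔾 L e g)
    (hZ : Z ∈ claimCone μ 𝔾 L e g) : (fun x => Y x + Z x) ∈ claimCone μ 𝔾 L e g := by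
  obtain ⟨l, hl, a, b, η, ha, hη, hle⟩ := hY
  obtain ⟨l', hl', a', b', η', ha', hη', hle'⟩ := hZ
  refine ⟨_, hL.add_mem hl hl', fun i => a i + a' i, fun j => b j + b' j,
    fun j t x => η j t x + η' j t x, fun i => add_nonneg (ha i) (ha' i), fun j => ?_, ?_⟩
  · exact ⟨fun t => ((hη j).measurable t).add ((hη' j).measurable t),
      fun t x => add_nonneg ((hη j).nonneg t x) ((hη' j).nonneg t x),
      fun x => by rw [Finset.sum_add_distrib, (hη j).sum_eq, (hη' j).sum_eq]⟩
  · filter_upwards [hle, hle'] with x hx hx'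
    simp only [optionPayoff, add_mul, mul_add, Finset.sum_add_distrib] at *
    linarith

theorem claimCone_smul {m₀ : MeasurableSpace X} {L : Set (X → ℝ)} (hL : IsModuleOver m₀ L)
    {e : ι → X → ℝ} {g : κ → Fin (T + 1) → X → ℝ} {Y : X → ℝ} {c : ℝ} (hc : 0 ≤ c)
    (hY : Y ∈ claimCone μ 𝔾 L e g) : (fun x => c * Y x) ∈ claimCone μ 𝔾 L e g := by
  obtain ⟨l, hl, a, b, η, ha, hη, hle⟩ := hY
  refine ⟨_, hL.mul_mem (φ := fun _ => c) measurable_const hl, fun i => c * a i, _,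
    fun j t x => c * η j t x, fun i => mul_nonneg hc (ha i), fun j => (hη j).smul hc, ?_⟩
  filter_upwards [hle] with x hx
  have h1 : optionPayoff e g (fun i => c * a i) (fun j t x => c * η j t x) x =
      c * optionPayoff e g a η x := by
    simpa using optionPayoff_sum e g {()} (fun _ => c) (fun _ => a) (fun _ => η) x
  rw [h1, ← mul_add]
  exact mul_le_mul_of_nonneg_left hx hc

end ClaimCone

/-! ### Separation of a closed cone from the positive functions. -/

section KrepsYan

variable {X : Type*} {mX : MeasurableSpace X} {μ : Measure X}

theorem inner_L2_eq_integral (Y Z : Lp ℝ 2 μ) : inner ℝ Z Y = ∫ x, Z x * Y x ∂μ := by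
  rw [L2.inner_def]
  simp [mul_comm]

/-- The Kreps–Yan separation theorem in `L²`. -/
theorem kreps_yan [IsFiniteMeasure μ] {C : Set (X → ℝ)}
    (hadd : ∀ Y ∈ C, ∀ Z ∈ C, (fun x => Y x + Z x) ∈ C)
    (hsmul : ∀ c : ℝ, 0 ≤ c → ∀ Y ∈ C, (fun x => c * Y x) ∈ C)
    (hmono : ∀ Y ∈ C, ∀ Z : X → ℝ, Z ≤ᵐ[μ] Y → Z ∈ C) (hzero : (fun _ => 0) ∈ C)
    (hcl : AEClosed μ C) (hC : ArbitrageFree μ C) :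
    ∃ Z : X → ℝ, StronglyMeasurable Z ∧ MemLp Z 2 μ ∧ (∀ᵐ x ∂μ, 0 < Z x) ∧
      ∀ Y ∈ C, MemLp Y 2 μ → ∫ x, Z x * Y x ∂μ ≤ 0 := by
  classical
  let K : Set (Lp ℝ 2 μ) := {Y | (Y : X → ℝ) ∈ C}
  have hcongr : ∀ {Y Z : X → ℝ}, Y =ᵐ[μ] Z → Y ∈ C → Z ∈ C := fun h hY =>
    hmono _ hY _ h.symm.le
  have hKsmul : ∀ c : ℝ, 0 ≤ c → ∀ Y ∈ K, c • Y ∈ K := fun c hc Y hY =>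
    hcongr (Lp.coeFn_smul c Y).symm (hsmul c hc _ hY)
  have hKadd : ∀ Y ∈ K, ∀ Z ∈ K, Y + Z ∈ K := fun Y hY Z hZ =>
    hcongr (Lp.coeFn_add Y Z).symm (hadd _ hY _ hZ)
  have hK0 : (0 : Lp ℝ 2 μ) ∈ K := hcongr (Lp.coeFn_zero ℝ 2 μ).symm hzero
  have hKconv : Convex ℝ K := fun Y hY Z hZ s t hs ht _ =>
    hKadd _ (hKsmul s hs Y hY) _ (hKsmul t ht Z hZ)
  have hKclosed : IsClosed K := by
    refine IsSeqClosed.isClosed fun Y Z hY hYZ => ?_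
    obtain ⟨φ, -, hφ⟩ := (tendstoInMeasure_of_tendsto_Lp hYZ).exists_seq_tendsto_ae
    exact hcl (fun n => Y (φ n)) Z (fun n => hY _) hφ
  -- the polar cone
  let K' : Set (Lp ℝ 2 μ) := {Z | ∀ Y ∈ K, inner ℝ Z Y ≤ 0}
  have hind : ∀ {A : Set X} (hA : MeasurableSet A) (Z : Lp ℝ 2 μ),
      inner ℝ Z (indicatorConstLp 2 hA (measure_ne_top μ A) (1 : ℝ)) = ∫ x in A, Z x ∂μ := by
    intro A hA Z
    rw [real_inner_comm, L2.inner_indicatorConstLp_one]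
  have hK'nonneg : ∀ Z ∈ K', ∀ᵐ x ∂μ, 0 ≤ Z x := by
    intro Z hZ
    refine ae_nonneg_of_forall_setIntegral_nonneg ((Lp.memLp Z).integrable one_le_two)
      fun A hA _ => ?_
    have hmem : -(indicatorConstLp 2 hA (measure_ne_top μ A) (1 : ℝ)) ∈ K := by
      refine hmono _ hzero _ ?_
      filter_upwards [Lp.coeFn_neg (indicatorConstLp 2 hA (measure_ne_top μ A) (1 : ℝ)),
        indicatorConstLp_coeFn (p := 2) (hs := hA) (hμs := measure_ne_top μ A) (c := (1 : ℝ))]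
        with x hx hx'
      rw [hx, Pi.neg_apply, hx']
      exact neg_nonpos.2 (Set.indicator_nonneg (fun _ _ => zero_le_one) _)
    have := hZ _ hmem
    rw [inner_neg_right, hind hA] at this
    linarith
  have hsep : ∀ A : Set X, MeasurableSet A → μ A ≠ 0 → ∃ Z ∈ K', 0 < ∫ x in A, Z x ∂μ := by
    intro A hA hμA
    have hnot : indicatorConstLp 2 hA (measure_ne_top μ A) (1 : ℝ) ∉ K := by
      intro h
      have hae := indicatorConstLp_coeFn (p := 2) (hs := hA) (hμs := measure_ne_top μ A)
        (c := (1 : ℝ))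
      have h1 := hC _ h (by
        filter_upwards [hae] with x hx
        rw [hx]
        exact Set.indicator_nonneg (fun _ _ => zero_le_one) _)
      refine hμA (measure_eq_zero_iff_ae_notMem.2 ?_)
      filter_upwards [h1, hae] with x hx hx' hxA
      rw [hx', Set.indicator_of_mem hxA] at hx
      exact one_ne_zero hx
    obtain ⟨F, u, hFK, hFu⟩ := geometric_hahn_banach_closed_point hKconv hKclosed hnot
    -- The separating functional is below `u` on the cone, which contains `0`. Hence `u > 0`, and
    -- scaling an element with positive value up to the level `u` is impossible, so the functional
    -- is nonpositive on `K`.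
    have hu : 0 < u := by simpa using hFK 0 hK0
    refine ⟨(InnerProductSpace.toDual ℝ _).symm F, fun Y hY => ?_, ?_⟩
    · rw [InnerProductSpace.toDual_symm_apply]
      by_contra! hpos
      have h1 := hFK _ (hKsmul (u / F Y) (by positivity) Y hY)
      rw [map_smul, smul_eq_mul, div_mul_cancel₀ _ hpos.ne'] at h1
      exact lt_irrefl _ h1
    · rw [← hind hA, InnerProductSpace.toDual_symm_apply]
      exact hu.trans hFu
  have hK'zero : (0 : Lp ℝ 2 μ) ∈ K' := fun Y _ => by rw [inner_zero_left]
  have hK'add : ∀ Z ∈ K', ∀ W ∈ K', Z + W ∈ K' := fun Z hZ W hW Y hY => by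
    rw [inner_add_left]
    exact add_nonpos (hZ Y hY) (hW Y hY)
  -- an element of the polar cone with maximal support
  let supp : Lp ℝ 2 μ → Set X := fun Z => {x | 0 < Z x}
  have hsupp : ∀ Z, MeasurableSet (supp Z) := fun Z =>
    measurableSet_lt measurable_const (Lp.stronglyMeasurable Z).measurable
  obtain ⟨u, -, hu, huK⟩ := exists_seq_tendsto_sSup (S := (fun Z => μ (supp Z)) '' K')
    ⟨_, 0, hK'zero, rfl⟩ (OrderTop.bddAbove _)
  choose Zs hZs hZu using huK
  let c : ℕ → ℝ := fun n => (1 / 2 : ℝ) ^ n * (1 + ‖Zs n‖)⁻¹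
  have hc : ∀ n, 0 < c n := fun n => by positivity
  have hsummable : Summable fun n => c n • Zs n := by
    refine Summable.of_norm_bounded (g := fun n => (1 / 2 : ℝ) ^ n) summable_geometric_two
      fun n => ?_
    rw [norm_smul, Real.norm_of_nonneg (hc n).le, mul_assoc]
    refine mul_le_of_le_one_right (by positivity) ?_
    rw [inv_mul_le_iff₀ (by positivity)]
    linarith
  set Z := ∑' n, c n • Zs n with hZdef
  have hinner : ∀ Y : Lp ℝ 2 μ, HasSum (fun n => c n * inner ℝ (Zs n) Y) (inner ℝ Z Y) := by
    intro Y
    have := hsummable.hasSum.mapL (innerSL ℝ Y)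
    simpa [inner_smul_right, real_inner_comm Y] using this
  have hZK : Z ∈ K' := fun Y hY =>
    (hinner Y).nonpos fun n => mul_nonpos_of_nonneg_of_nonpos (hc n).le (hZs n Y hY)
  -- On `{Z ≤ 0}` the nonnegative terms of the series have total integral at most `0`, so each `Zs
  -- n` vanishes there almost everywhere.
  have hsup : ∀ n, μ (supp (Zs n)) ≤ μ (supp Z) := by
    intro n
    refine measure_mono_ae ?_
    have hA : MeasurableSet {x | Z x ≤ 0} :=
      measurableSet_le (Lp.stronglyMeasurable Z).measurable measurable_const
    have hs := hinner (indicatorConstLp 2 hA (measure_ne_top μ _) (1 : ℝ))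
    simp only [hind hA] at hs
    have hnn : ∀ k, 0 ≤ ∫ x in {x | Z x ≤ 0}, Zs k x ∂μ := fun k =>
      integral_nonneg_of_ae (ae_restrict_of_ae (hK'nonneg _ (hZs k)))
    have h1 : ∫ x in {x | Z x ≤ 0}, Z x ∂μ ≤ 0 := setIntegral_nonpos hA fun x hx => hx
    have h2 := (le_hasSum hs n fun k _ => mul_nonneg (hc k).le (hnn k)).trans h1
    have h3 : ∫ x in {x | Z x ≤ 0}, Zs n x ∂μ = 0 :=
      le_antisymm (by have := hc n; by_contra! h; nlinarith [mul_pos this h]) (hnn n)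
    rw [setIntegral_eq_zero_iff_of_nonneg_ae (ae_restrict_of_ae (hK'nonneg _ (hZs n)))
      ((Lp.memLp (Zs n)).integrable one_le_two).integrableOn] at h3
    filter_upwards [(ae_restrict_iff' hA).1 h3] with x hx (hx' : 0 < Zs n x)
    change 0 < Z x
    by_contra! hneg
    exact hx'.ne' (hx hneg)
  have hmax : ∀ W ∈ K', μ (supp W) ≤ μ (supp Z) := fun W hW =>
    (le_sSup (Set.mem_image_of_mem _ hW)).trans
      (le_of_tendsto' hu fun n => by rw [← hZu n]; exact hsup n)
  refine ⟨Z, Lp.stronglyMeasurable Z, Lp.memLp Z, ?_, fun Y hY hY2 => ?_⟩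
  · by_contra hnot
    have hA : MeasurableSet {x | Z x ≤ 0} :=
      measurableSet_le (Lp.stronglyMeasurable Z).measurable measurable_const
    have hμA : μ {x | Z x ≤ 0} ≠ 0 := fun h => hnot (by
      simpa using measure_eq_zero_iff_ae_notMem.1 h)
    -- If `Z` vanished on a nonnull set, a polar element `W` charging that set could be added to
    -- `Z`, giving a strictly larger support.
    obtain ⟨W, hW, hWpos⟩ := hsep _ hA hμA
    have h1 := hmax _ (hK'add Z hZK W hW)
    have h2 : μ ({x | Z x ≤ 0} ∩ supp W) ≠ 0 := by
      intro h
      refine hWpos.ne' ?_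
      rw [setIntegral_eq_zero_iff_of_nonneg_ae (ae_restrict_of_ae (hK'nonneg _ hW))
        ((Lp.memLp W).integrable one_le_two).integrableOn, EventuallyEq, ae_restrict_iff' hA]
      filter_upwards [measure_eq_zero_iff_ae_notMem.1 h, hK'nonneg _ hW] with x hx hx0 hxA
      exact le_antisymm (not_lt.1 fun hlt => hx ⟨hxA, hlt⟩) hx0
    have h3 : μ (supp Z) + μ ({x | Z x ≤ 0} ∩ supp W) ≤ μ (supp (Z + W)) := by
      have hdisj : Disjoint (supp Z) ({x | Z x ≤ 0} ∩ supp W) :=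
        Set.disjoint_left.2 fun x (hx : 0 < Z x) hx' => not_lt.2 hx'.1 hx
      rw [← measure_union hdisj (hA.inter (hsupp W))]
      refine measure_mono_ae ?_
      filter_upwards [Lp.coeFn_add Z W, hK'nonneg _ hW, hK'nonneg _ hZK] with x hx hW0 hZ0 hmem
      change 0 < (Z + W : Lp ℝ 2 μ) x
      rw [hx, Pi.add_apply]
      rcases hmem with (h : 0 < Z x) | ⟨-, (h : 0 < W x)⟩ <;> linarith
    have h4 : μ (supp Z) + μ ({x | Z x ≤ 0} ∩ supp W) ≤ μ (supp Z) + 0 := by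
      rw [add_zero]; exact h3.trans h1
    exact h2 (le_antisymm ((ENNReal.add_le_add_iff_left (measure_ne_top μ _)).1 h4) bot_le)
  · have h1 := hZK (hY2.toLp Y) (hcongr hY2.coeFn_toLp.symm hY)
    rw [inner_L2_eq_integral] at h1
    refine le_of_eq_of_le (integral_congr_ae ?_) h1
    filter_upwards [hY2.coeFn_toLp] with x hx
    rw [hx]

end KrepsYan

/-! ### Stochastic integrals bounded below. -/

section BoundedBelow

variable {X : Type*} {mX : MeasurableSpace X} {Q : Measure X} [IsFiniteMeasure Q]
  {E : Type*} [NormedAddCommGroup E] [InnerProductSpace ℝ E] [CompleteSpace E]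

/-- The bound on `h` makes the product integrable, so `h` can be pulled out of the conditional
expectation. -/
theorem integral_inner_eq_zero_of_condExp_eq_zero {m : MeasurableSpace X} (hm : m ≤ mX)
    {h ξ : X → E} (hh : StronglyMeasurable[m] h) {B : ℝ} (hB : ∀ x, ‖h x‖ ≤ B)
    (hξ : Integrable ξ Q) (hξ0 : Q[ξ|m] =ᵐ[Q] 0) :
    Integrable (fun x => inner ℝ (h x) (ξ x)) Q ∧ ∫ x, inner ℝ (h x) (ξ x) ∂Q = 0 := by
  have hint : Integrable (fun x => inner ℝ (h x) (ξ x)) Q := by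
    refine (hξ.norm.const_mul B).mono'
      ((hh.mono hm).aestronglyMeasurable.inner hξ.aestronglyMeasurable) (ae_of_all _ fun x => ?_)
    exact (norm_inner_le_norm _ _).trans (mul_le_mul_of_nonneg_right (hB x) (norm_nonneg _))
  refine ⟨hint, ?_⟩
  have h1 := condExp_bilin_of_stronglyMeasurable_left (innerSL ℝ) hh hint hξ
  rw [← integral_condExp hm]
  refine integral_eq_zero_of_ae ?_
  filter_upwards [h1, hξ0] with x hx hx'
  refine hx.trans ?_
  simp [hx']

/-- A predictable bet on a variable of vanishing conditional mean that is bounded below started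
from a value bounded below, and its mean does not exceed that of the initial value. -/
theorem bounded_below_step {m : MeasurableSpace X} (hm : m ≤ mX) {Y : X → ℝ} {h ξ : X → E}
    (hY : StronglyMeasurable[m] Y) (hh : StronglyMeasurable[m] h) (hξ : Integrable ξ Q)
    (hξ0 : Q[ξ|m] =ᵐ[Q] 0) {c : ℝ} (hV : ∀ᵐ x ∂Q, -c ≤ Y x + inner ℝ (h x) (ξ x)) :
    (∀ᵐ x ∂Q, -c ≤ Y x) ∧ ∫⁻ x, ENNReal.ofReal (Y x + inner ℝ (h x) (ξ x) + c) ∂Q ≤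
      ∫⁻ x, ENNReal.ofReal (Y x + c) ∂Q := by
  -- Neither `Y` nor `h` is assumed integrable or bounded. On the `m`-measurable sets `A n`, which
  -- exhaust the space, both are bounded and the bet has mean zero.
  let A : ℕ → Set X := fun n => {x | ‖Y x‖ ≤ n} ∩ {x | ‖h x‖ ≤ n}
  have hAm : ∀ n, MeasurableSet[m] (A n) := fun n =>
    (hY.norm.measurableSet_le stronglyMeasurable_const).inter
      (hh.norm.measurableSet_le stronglyMeasurable_const)
  have hAuniv : ⋃ n, A n = Set.univ := by
    refine Set.eq_univ_of_forall fun x => ?_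
    obtain ⟨n, hn⟩ := exists_nat_ge (max ‖Y x‖ ‖h x‖)
    exact Set.mem_iUnion.2 ⟨n, (le_max_left _ _).trans hn, (le_max_right _ _).trans hn⟩
  have hAmono : Monotone A := fun n k hnk x hx =>
    ⟨le_trans (show ‖Y x‖ ≤ n from hx.1) (Nat.cast_le.2 hnk),
      le_trans (show ‖h x‖ ≤ n from hx.2) (Nat.cast_le.2 hnk)⟩
  have hYint : ∀ n (B : Set X), MeasurableSet[m] B → IntegrableOn (fun x => Y x + c) (A n ∩ B) Q := by
    intro n B hB
    refine Integrable.add ?_ (integrable_const c)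
    refine Integrable.mono' (integrable_const (n : ℝ)) (hY.mono hm).aestronglyMeasurable ?_
    rw [ae_restrict_iff' (hm _ ((hAm n).inter hB))]
    exact ae_of_all _ fun x hx => hx.1.1
  have hinner : ∀ n (B : Set X), MeasurableSet[m] B →
      IntegrableOn (fun x => inner ℝ (h x) (ξ x)) (A n ∩ B) Q ∧
        ∫ x in A n ∩ B, inner ℝ (h x) (ξ x) ∂Q = 0 := by
    intro n B hB
    have hAB := (hAm n).inter hB
    have h1 := integral_inner_eq_zero_of_condExp_eq_zero hm (hh.indicator hAB) (B := n) (fun x => by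
      by_cases hx : x ∈ A n ∩ B
      · rw [Set.indicator_of_mem hx]; exact hx.1.2
      · rw [Set.indicator_of_notMem hx, norm_zero]; positivity) hξ hξ0
    have h2 : (fun x => inner ℝ ((A n ∩ B).indicator h x) (ξ x)) =
        (A n ∩ B).indicator (fun x => inner ℝ (h x) (ξ x)) := by
      ext x
      by_cases hx : x ∈ A n ∩ B <;> simp [hx]
    rwa [h2, integrable_indicator_iff (hm _ hAB), integral_indicator (hm _ hAB)] at h1
  have hVint : ∀ n (B : Set X), MeasurableSet[m] B →
      IntegrableOn (fun x => Y x + inner ℝ (h x) (ξ x) + c) (A n ∩ B) Q ∧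
      ∫ x in A n ∩ B, (Y x + inner ℝ (h x) (ξ x) + c) ∂Q = ∫ x in A n ∩ B, (Y x + c) ∂Q := by
    intro n B hB
    have h1 : (fun x => Y x + inner ℝ (h x) (ξ x) + c) =
        fun x => (Y x + c) + inner ℝ (h x) (ξ x) := by ext x; ring
    rw [h1]
    refine ⟨(hYint n B hB).add (hinner n B hB).1, ?_⟩
    rw [integral_add (hYint n B hB) (hinner n B hB).1, (hinner n B hB).2, add_zero]
  have hVnn : ∀ᵐ x ∂Q, 0 ≤ Y x + inner ℝ (h x) (ξ x) + c := by
    filter_upwards [hV] with x hx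
    linarith
  have hlow : ∀ᵐ x ∂Q, -c ≤ Y x := by
    have hB : MeasurableSet[m] {x | Y x < -c} := hY.measurableSet_lt stronglyMeasurable_const
    have hn : ∀ n, ∀ᵐ x ∂Q, x ∈ A n → -c ≤ Y x := by
      intro n
      have hAB := hm _ ((hAm n).inter hB)
      -- This integral equals that of the nonnegative `Y + ⟪h, ξ⟫ + c`, while `Y + c` is negative on
      -- the set; so the set is null.
      have h1 : 0 ≤ ∫ x in A n ∩ {x | Y x < -c}, (Y x + c) ∂Q := by
        rw [← (hVint n _ hB).2]
        exact integral_nonneg_of_ae (ae_restrict_of_ae hVnn)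
      have h2 : 0 ≤ᵐ[Q.restrict (A n ∩ {x | Y x < -c})] fun x => -(Y x + c) := by
        refine (ae_restrict_iff' hAB).2 (ae_of_all _ fun x hx => ?_)
        have : Y x < -c := hx.2
        simp only [Pi.zero_apply]; linarith
      have h3 : ∫ x in A n ∩ {x | Y x < -c}, -(Y x + c) ∂Q = 0 :=
        le_antisymm (by rw [integral_neg]; linarith) (integral_nonneg_of_ae h2)
      rw [setIntegral_eq_zero_iff_of_nonneg_ae h2 (hYint n _ hB).neg, EventuallyEq,
        ae_restrict_iff' hAB] at h3
      filter_upwards [h3] with x hx hxA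
      by_contra! hlt
      have := hx ⟨hxA, hlt⟩
      simp only [Pi.zero_apply] at this
      linarith
    filter_upwards [ae_all_iff.2 hn] with x hx
    obtain ⟨n, hxn⟩ := Set.mem_iUnion.1 (hAuniv ▸ Set.mem_univ x)
    exact hx n hxn
  refine ⟨hlow, ?_⟩
  calc ∫⁻ x, ENNReal.ofReal (Y x + inner ℝ (h x) (ξ x) + c) ∂Q
      = ⨆ n, ∫⁻ x in A n, ENNReal.ofReal (Y x + inner ℝ (h x) (ξ x) + c) ∂Q := by
        rw [← setLIntegral_iUnion_of_directed _ hAmono.directed_le, hAuniv, Measure.restrict_univ]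
    _ ≤ _ := iSup_le fun n => by
        have h1 := hVint n Set.univ MeasurableSet.univ
        have h2 := hYint n Set.univ MeasurableSet.univ
        rw [Set.inter_univ] at h1 h2
        rw [← ofReal_integral_eq_lintegral_ofReal h1.1 (ae_restrict_of_ae hVnn), h1.2,
          ofReal_integral_eq_lintegral_ofReal h2 (ae_restrict_of_ae (by
            filter_upwards [hlow] with x hx
            simp only [Pi.zero_apply]; linarith))]
        exact setLIntegral_le_lintegral _ _

/-- The gains of a predictable strategy in a martingale, if bounded below, are integrable with
nonpositive mean. -/
theorem integral_gains_nonpos {T : ℕ} {𝔾 : Filtration (Fin (T + 1)) mX} {S : Fin (T + 1) → X → E}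
    (hS : Martingale S 𝔾 Q) {H : Fin (T + 1) → X → E} (hH : StronglyAdapted 𝔾 H) {c : ℝ}
    (hc : ∀ᵐ x ∂Q, -c ≤ ∑ t : Fin T, inner ℝ (H t.castSucc x) (S t.succ x - S t.castSucc x)) :
    Integrable (fun x => ∑ t : Fin T, inner ℝ (H t.castSucc x) (S t.succ x - S t.castSucc x)) Q ∧
      ∫ x, ∑ t : Fin T, inner ℝ (H t.castSucc x) (S t.succ x - S t.castSucc x) ∂Q ≤ 0 := by
  let V : ℕ → X → ℝ := fun k x =>
    ∑ t : Fin T with t.val < k, inner ℝ (H t.castSucc x) (S t.succ x - S t.castSucc x)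
  have hVT : V T = fun x => ∑ t : Fin T, inner ℝ (H t.castSucc x) (S t.succ x - S t.castSucc x) := by
    ext x
    exact Finset.sum_congr (Finset.filter_true_of_mem fun t _ => t.2) fun _ _ => rfl
  have hVstep : ∀ k (hk : k < T), V (k + 1) = fun x => V k x +
      inner ℝ (H (Fin.castSucc ⟨k, hk⟩) x) (S (Fin.succ ⟨k, hk⟩) x - S (Fin.castSucc ⟨k, hk⟩) x) := by
    intro k hk
    ext x
    have : (Finset.univ.filter fun s : Fin T => s.val < k + 1) =
        insert ⟨k, hk⟩ (Finset.univ.filter fun s : Fin T => s.val < k) := by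
      ext s
      simp only [Finset.mem_filter_univ, Finset.mem_insert, Fin.ext_iff]
      omega
    simp only [V]
    rw [this, Finset.sum_insert (by simp)]
    ring
  have hVm : ∀ k (t : Fin (T + 1)), k ≤ t.val → StronglyMeasurable[𝔾 t] (V k) := by
    intro k t hk
    refine Finset.stronglyMeasurable_fun_sum _ fun s hs => ?_
    rw [Finset.mem_filter_univ] at hs
    have h1 : s.castSucc ≤ t := by rw [Fin.le_def, Fin.val_castSucc]; omega
    have h2 : s.succ ≤ t := by rw [Fin.le_def, Fin.val_succ]; omega
    exact ((hH _).mono (𝔾.mono h1)).inner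
      (((hS.stronglyMeasurable _).mono (𝔾.mono h2)).sub
        ((hS.stronglyMeasurable _).mono (𝔾.mono h1)))
  replace hc : ∀ᵐ x ∂Q, -c ≤ V T x := by rwa [hVT]
  rw [← hVT]
  have key : (∀ᵐ x ∂Q, -c ≤ V 0 x) ∧
      ∫⁻ x, ENNReal.ofReal (V T x + c) ∂Q ≤ ∫⁻ x, ENNReal.ofReal (V 0 x + c) ∂Q := by
    -- Only the terminal gain is assumed bounded below, so the bound is passed backwards in time.
    -- The means are compared as `lintegral`s because integrability of `V k` is not yet known.
    refine Nat.decreasingInduction (motive := fun k _ => (∀ᵐ x ∂Q, -c ≤ V k x) ∧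
      ∫⁻ x, ENNReal.ofReal (V T x + c) ∂Q ≤ ∫⁻ x, ENNReal.ofReal (V k x + c) ∂Q)
      (fun k hk ih => ?_) ⟨hc, le_rfl⟩ (Nat.zero_le T)
    rw [hVstep k hk] at ih
    have h0 : Q[fun x => S (Fin.succ ⟨k, hk⟩) x - S (Fin.castSucc ⟨k, hk⟩) x |
        𝔾 (Fin.castSucc ⟨k, hk⟩)] =ᵐ[Q] 0 := by
      refine (condExp_sub (hS.integrable _) (hS.integrable _) _).trans ?_
      filter_upwards [hS.condExp_ae_eq (Fin.castSucc_lt_succ (i := ⟨k, hk⟩)).le,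
        hS.condExp_ae_eq (le_refl (Fin.castSucc ⟨k, hk⟩))] with x hx hx'
      rw [Pi.sub_apply, hx, hx', sub_self, Pi.zero_apply]
    obtain ⟨h1, h2⟩ := bounded_below_step (𝔾.le (Fin.castSucc ⟨k, hk⟩)) (hVm k _ le_rfl)
      (hH _) ((hS.integrable _).sub (hS.integrable _)) h0 ih.1
    exact ⟨h1, ih.2.trans h2⟩
  have hV0 : V 0 = fun _ => 0 := by ext x; simp [V]
  have hmeas : StronglyMeasurable (V T) := (hVm T (Fin.last T) le_rfl).mono (𝔾.le _)
  have hnn : 0 ≤ᵐ[Q] fun x => V T x + c := by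
    filter_upwards [hc] with x hx
    simp only [Pi.zero_apply]; linarith
  have hle : ∫⁻ x, ENNReal.ofReal (V T x + c) ∂Q ≤ ENNReal.ofReal c * Q Set.univ := by
    simpa [hV0] using key.2
  have hfin : ENNReal.ofReal c * Q Set.univ ≠ ⊤ :=
    ENNReal.mul_ne_top ENNReal.ofReal_ne_top (measure_ne_top _ _)
  have hint : Integrable (fun x => V T x + c) Q :=
    ⟨(hmeas.add stronglyMeasurable_const).aestronglyMeasurable, by
      rw [hasFiniteIntegral_iff_ofReal hnn]
      exact hle.trans_lt hfin.lt_top⟩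
  have hint' : Integrable (V T) Q := by
    refine (hint.sub (integrable_const c)).congr (ae_of_all _ fun x => ?_)
    simp
  refine ⟨hint', ?_⟩
  rcases eq_zero_or_neZero Q with rfl | _
  · simp
  have hc0 : 0 ≤ c := by
    obtain ⟨x, hx⟩ := key.1.exists
    rw [hV0] at hx
    linarith
  have h1 : ∫ x, (V T x + c) ∂Q ≤ c * Q.real Set.univ := by
    rw [integral_eq_lintegral_of_nonneg_ae hnn hint.aestronglyMeasurable]
    refine (ENNReal.toReal_mono hfin hle).trans ?_
    rw [ENNReal.toReal_mul, ENNReal.toReal_ofReal hc0, Measure.real]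
  rw [integral_add hint' (integrable_const c), integral_const, smul_eq_mul] at h1
  linarith

end BoundedBelow

/-! ### Exercise strategies as mixtures of stopping times. -/

section RandomizedStopping

variable {X : Type*} {mX : MeasurableSpace X} {T : ℕ} {𝔾 : Filtration (Fin (T + 1)) mX}

/-- The time at which an exercise strategy has exercised the proportion `u`. -/
theorem exists_stoppingTime_of_level {η : Fin (T + 1) → X → ℝ} (hη : IsExercise 𝔾 1 η) {u : ℝ}
    (hu0 : 0 < u) (hu1 : u ≤ 1) :
    ∃ τ : X → Fin (T + 1), IsStoppingTime 𝔾 (fun x => (τ x : WithTop (Fin (T + 1)))) ∧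
      ∀ x t, τ x = t ↔ (∑ s : Fin (T + 1) with s.val < t.val, η s x) < u ∧
        u ≤ ∑ s : Fin (T + 1) with s.val < t.val + 1, η s x := by
  classical
  let A : ℕ → X → ℝ := fun k x => ∑ s : Fin (T + 1) with s.val < k, η s x
  have hA0 : ∀ x, A 0 x = 0 := fun x => by simp [A]
  have hAmono : ∀ x, Monotone fun k => A k x := fun x k l hkl =>
    Finset.sum_le_sum_of_subset_of_nonneg
      (fun t => by simp only [Finset.mem_filter_univ]; omega) fun t _ _ => hη.nonneg t x
  have hAT : ∀ x, A (T + 1) x = 1 := fun x => by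
    rw [← hη.sum_eq x]
    exact Finset.sum_congr (Finset.filter_true_of_mem fun t _ => t.2) fun _ _ => rfl
  have hex : ∀ x, ∃ k, u ≤ A (k + 1) x := fun x => ⟨T, by rw [hAT]; exact hu1⟩
  have hfind : ∀ x (k : ℕ), Nat.find (hex x) ≤ k ↔ u ≤ A (k + 1) x := fun x k =>
    ⟨fun h => (Nat.find_spec (hex x)).trans (hAmono x (Nat.succ_le_succ h)),
      fun h => Nat.find_min' _ h⟩
  refine ⟨fun x => ⟨Nat.find (hex x), Nat.lt_succ_of_le ((hfind x T).2 (by rw [hAT]; exact hu1))⟩,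
    fun t => ?_, fun x t => ?_⟩
  · have : {x | ((⟨Nat.find (hex x), Nat.lt_succ_of_le ((hfind x T).2 (by rw [hAT]; exact hu1))⟩ :
        Fin (T + 1)) : WithTop (Fin (T + 1))) ≤ t} = {x | u ≤ A (t + 1) x} := by
      ext x
      simp only [Set.mem_ofPred_eq, WithTop.coe_le_coe, Fin.le_def]
      exact hfind x t
    rw [this]
    refine measurableSet_le measurable_const (Finset.measurable_sum _ fun s hs => ?_)
    rw [Finset.mem_filter_univ] at hs
    exact (hη.measurable s).mono (𝔾.mono (by rw [Fin.le_def]; omega)) le_rfl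
  · change _ ↔ A t x < u ∧ u ≤ A (t + 1) x
    rw [Fin.ext_iff, le_antisymm_iff, hfind, and_comm]
    -- The remaining claim says that `τ x` is at least `t` exactly when level `u` is not reached
    -- before `t`; at `t = 0` this is where `0 < u` enters.
    refine and_congr_left fun _ => ?_
    obtain ⟨k, hk⟩ : ∃ k, k = t.val := ⟨_, rfl⟩
    rw [← hk]
    rcases k with _ | k
    · simp [hA0, hu0]
    · rw [Nat.succ_le_iff, ← not_le, hfind, not_le]

/-- Randomised exercise does not improve on stopping times. -/
theorem integral_exercise_le {Q : Measure X} [IsFiniteMeasure Q] {g : Fin (T + 1) → X → ℝ}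
    (hg : ∀ t, Measurable (g t)) {C : ℝ} (hC : ∀ t x, |g t x| ≤ C) {q : ℝ}
    (hq : ∀ τ : X → Fin (T + 1), IsStoppingTime 𝔾 (fun x => (τ x : WithTop (Fin (T + 1)))) →
      ∫ x, g (τ x) x ∂Q ≤ q)
    {η : Fin (T + 1) → X → ℝ} (hη : IsExercise 𝔾 1 η) :
    ∫ x, ∑ t, g t x * η t x ∂Q ≤ q := by
  let A : ℕ → X → ℝ := fun k x => ∑ s : Fin (T + 1) with s.val < k, η s x
  have hηm : ∀ t, Measurable (η t) := fun t => (hη.measurable t).mono (𝔾.le t) le_rfl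
  have hAm : ∀ k, Measurable (A k) := fun k => Finset.measurable_sum _ fun s _ => hηm s
  have hA0 : ∀ k x, 0 ≤ A k x := fun k x => Finset.sum_nonneg fun s _ => hη.nonneg s x
  have hA1 : ∀ k x, A k x ≤ 1 := fun k x => by
    rw [← hη.sum_eq x]
    exact Finset.sum_le_sum_of_subset_of_nonneg (Finset.filter_subset _ _)
      fun t _ _ => hη.nonneg t x
  have hstep : ∀ (t : Fin (T + 1)) x, A (t + 1) x - A t x = η t x := by
    intro t x
    have : (Finset.univ.filter fun s : Fin (T + 1) => s.val < t.val + 1) =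
        insert t (Finset.univ.filter fun s : Fin (T + 1) => s.val < t.val) := by
      ext s
      simp only [Finset.mem_filter_univ, Finset.mem_insert, Fin.ext_iff]
      omega
    simp only [A]
    rw [this, Finset.sum_insert (by simp)]
    ring
  -- The intervals `(A t x, A (t + 1) x]` partition `(0, 1]` and have lengths `η t x`. For fixed `u`
  -- the function is `g` stopped at the time of level `u`, and integrating over `u` first gives the
  -- payoff of `η`; Fubini compares the two.
  let G : X → ℝ → ℝ := fun x u =>
    ∑ t : Fin (T + 1), g t x * (Set.Ioc (A t x) (A (t + 1) x)).indicator (fun _ => (1 : ℝ)) u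
  have hind : ∀ (t : Fin (T + 1)) x u,
      |(Set.Ioc (A t x) (A (t + 1) x)).indicator (fun _ => (1 : ℝ)) u| ≤ 1 := fun t x u => by
    by_cases h : u ∈ Set.Ioc (A t x) (A (t + 1) x) <;> simp [h]
  have hGm : Measurable (Function.uncurry G) := by
    refine Finset.measurable_sum _ fun t _ => ((hg t).comp measurable_fst).mul ?_
    have hset : MeasurableSet {p : X × ℝ | A t p.1 < p.2 ∧ p.2 ≤ A (t + 1) p.1} :=
      (measurableSet_lt ((hAm _).comp measurable_fst) measurable_snd).inter
        (measurableSet_le measurable_snd ((hAm _).comp measurable_fst))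
    exact measurable_const.indicator (f := fun _ : X × ℝ => (1 : ℝ)) hset
  have hGint : Integrable (Function.uncurry G) (Q.prod (volume.restrict (Set.Ioc (0 : ℝ) 1))) := by
    refine Integrable.of_bound hGm.aestronglyMeasurable (∑ _t : Fin (T + 1), C)
      (ae_of_all _ fun p => ?_)
    refine (norm_sum_le _ _).trans (Finset.sum_le_sum fun t _ => ?_)
    rw [norm_mul]
    exact (mul_le_of_le_one_right (norm_nonneg _) (hind t _ _)).trans (hC t _)
  have hinner : ∀ x, ∫ u in Set.Ioc (0 : ℝ) 1, G x u = ∑ t, g t x * η t x := by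
    intro x
    rw [integral_finsetSum _ fun t _ => ?_]
    · refine Finset.sum_congr rfl fun t _ => ?_
      rw [integral_const_mul, integral_indicator measurableSet_Ioc,
        Measure.restrict_restrict measurableSet_Ioc, Set.inter_eq_left.2
          (Set.Ioc_subset_Ioc (hA0 _ x) (hA1 _ x)), integral_const, smul_eq_mul, mul_one,
        Measure.real, Measure.restrict_apply_univ, Real.volume_Ioc, hstep,
        ENNReal.toReal_ofReal (hη.nonneg t x)]
    · exact (((integrable_const (1 : ℝ)).indicator measurableSet_Ioc)).const_mul _
  calc ∫ x, ∑ t, g t x * η t x ∂Q = ∫ x, (∫ u in Set.Ioc (0 : ℝ) 1, G x u) ∂Q := by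
        simp only [hinner]
    _ = ∫ u in Set.Ioc (0 : ℝ) 1, ∫ x, G x u ∂Q := integral_integral_swap hGint
    _ ≤ ∫ _u in Set.Ioc (0 : ℝ) 1, q := by
        refine setIntegral_mono_on hGint.integral_prod_right (integrable_const q)
          measurableSet_Ioc fun u hu => ?_
        obtain ⟨τ, hτ, hτu⟩ := exists_stoppingTime_of_level hη hu.1 hu.2
        refine le_of_eq_of_le (integral_congr_ae (ae_of_all _ fun x => ?_)) (hq τ hτ)
        simp only [G]
        rw [Finset.sum_eq_single (τ x)]
        · have : u ∈ Set.Ioc (A (τ x) x) (A (τ x + 1) x) := (hτu x (τ x)).1 rfl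
          simp [this]
        · intro t _ ht
          have : u ∉ Set.Ioc (A t x) (A (t + 1) x) := fun h => ht ((hτu x t).2 h).symm
          simp [this]
        · simp
    _ = q := by simp

end RandomizedStopping

/-! ### Construction of the martingale measure. -/

section MartingaleMeasure

theorem stronglyMeasurable_toLp {X : Type*} {m : MeasurableSpace X} {d : ℕ} {φ : Fin d → X → ℝ}
    (hφ : ∀ i, Measurable (φ i)) : StronglyMeasurable
      (fun x => (WithLp.toLp 2 fun i => φ i x : EuclideanSpace ℝ (Fin d))) :=
  ((WithLp.measurable_toLp 2 (Fin d → ℝ)).comp (measurable_pi_lambda _ hφ)).stronglyMeasurable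

variable {X : Type*} {mX : MeasurableSpace X} {T d : ℕ} {𝔾 : Filtration (Fin (T + 1)) mX}

/-- The gains of the dynamic trading strategies in the process `S`. -/
def gains (𝔾 : Filtration (Fin (T + 1)) mX) (S : Fin (T + 1) → X → EuclideanSpace ℝ (Fin d)) :
    Set (X → ℝ) :=
  {V | ∃ H : Fin (T + 1) → X → EuclideanSpace ℝ (Fin d), StronglyAdapted 𝔾 H ∧
    V = fun x => ∑ t : Fin T, inner ℝ (H t.castSucc x) (S t.succ x - S t.castSucc x)}

theorem gains_eq_combinations (S : Fin (T + 1) → X → EuclideanSpace ℝ (Fin d)) :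
    gains 𝔾 S = combinations (fun p : Fin T × Fin d => 𝔾 p.1.castSucc)
      (fun p x => (S p.1.succ x - S p.1.castSucc x) p.2) Finset.univ := by
  ext V
  constructor
  · rintro ⟨H, hH, rfl⟩
    refine ⟨fun p x => H p.1.castSucc x p.2, fun p => ?_, ?_⟩
    · exact ((EuclideanSpace.proj p.2 : EuclideanSpace ℝ (Fin d) →L[ℝ] ℝ).continuous.comp_stronglyMeasurable
        (hH p.1.castSucc)).measurable
    · ext x
      rw [Fintype.sum_prod_type]
      refine Finset.sum_congr rfl fun t _ => ?_
      rw [PiLp.inner_apply]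
      refine Finset.sum_congr rfl fun i _ => ?_
      simp [mul_comm]
  · rintro ⟨φ, hφ, rfl⟩
    -- The position at the last date never enters the gains, and is set to `0`.
    refine ⟨fun t => Fin.lastCases (motive := fun _ => X → EuclideanSpace ℝ (Fin d)) (fun _ => 0)
      (fun t x => WithLp.toLp 2 fun i => φ (t, i) x) t, fun t => ?_, ?_⟩
    · refine Fin.lastCases ?_ (fun t => ?_) t
      · dsimp only
        rw [Fin.lastCases_last]
        exact stronglyMeasurable_const
      · dsimp only
        rw [Fin.lastCases_castSucc]
        exact stronglyMeasurable_toLp fun i => hφ (t, i)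
    · ext x
      rw [Fintype.sum_prod_type]
      refine Finset.sum_congr rfl fun t _ => ?_
      rw [PiLp.inner_apply]
      refine Finset.sum_congr rfl fun i _ => ?_
      simp [mul_comm]

theorem isModuleOver_gains (S : Fin (T + 1) → X → EuclideanSpace ℝ (Fin d)) :
    IsModuleOver (𝔾 0) (gains 𝔾 S) := by
  rw [gains_eq_combinations]
  exact isModuleOver_combinations fun p _ => 𝔾.mono (Fin.zero_le _)

theorem aeclosed_dominated_gains {μ : Measure X} {S : Fin (T + 1) → X → EuclideanSpace ℝ (Fin d)}
    (hNA : ArbitrageFree μ (gains 𝔾 S)) : AEClosed μ (dominated μ (gains 𝔾 S)) := by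
  rw [gains_eq_combinations] at hNA ⊢
  exact aeclosed_dominated_combinations (fun p : Fin T × Fin d => p.1.castSucc) (fun p q h => 𝔾.mono h) _ hNA

/-- A bet on one increment of the price process is a gain. -/
theorem indicator_inner_mem_gains (S : Fin (T + 1) → X → EuclideanSpace ℝ (Fin d)) (u : Fin T)
    {A : Set X} (hA : MeasurableSet[𝔾 u.castSucc] A) (v : EuclideanSpace ℝ (Fin d)) :
    A.indicator (fun x => inner ℝ v (S u.succ x - S u.castSucc x)) ∈ gains 𝔾 S := by
  classical
  refine ⟨fun t => if t = u.castSucc then A.indicator fun _ => v else fun _ => 0, fun t => ?_, ?_⟩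
  · dsimp only
    split_ifs with h
    · subst h
      exact stronglyMeasurable_const.indicator hA
    · exact stronglyMeasurable_const
  · ext x
    rw [Finset.sum_eq_single u]
    · by_cases hx : x ∈ A <;> simp [hx]
    · intro t _ ht
      simp [ht]
    · simp

/-- One-step martingales are martingales. -/
theorem martingale_of_condExp_succ {E : Type*} [NormedAddCommGroup E] [NormedSpace ℝ E]
    [CompleteSpace E] {Q : Measure X} [IsFiniteMeasure Q] {S : Fin (T + 1) → X → E}
    (hS : StronglyAdapted 𝔾 S) (hint : ∀ t, Integrable (S t) Q)
    (h : ∀ u : Fin T, S u.castSucc =ᵐ[Q] Q[S u.succ | 𝔾 u.castSucc]) : Martingale S 𝔾 Q := by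
  refine ⟨hS, fun i j => ?_⟩
  have hself : ∀ i, Q[S i | 𝔾 i] =ᵐ[Q] S i := fun i => by
    rw [condExp_of_stronglyMeasurable (𝔾.le i) (hS i) (hint i)]
  induction j using Fin.induction with
  | zero =>
    intro hi
    rw [Fin.le_zero_iff.1 hi]
    exact hself 0
  | succ j ih =>
    intro hi
    rcases hi.eq_or_lt with rfl | hlt
    · exact hself _
    · have hij : i ≤ j.castSucc := Fin.le_castSucc_iff.2 hlt
      exact (condExp_condExp_of_le (𝔾.mono hij) (𝔾.le _)).symm.trans
        ((condExp_congr_ae (h j).symm).trans (ih hij))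

section OptionMembership

variable {ι κ : Type*} [Fintype ι] [Fintype κ] {μ : Measure X} {L : Set (X → ℝ)}
  {m₀ : MeasurableSpace X} {e : ι → X → ℝ} {g : κ → Fin (T + 1) → X → ℝ}

theorem isExercise_zero : IsExercise 𝔾 0 (fun _ _ => 0) :=
  ⟨fun _ => measurable_const, fun _ _ => le_rfl, fun _ => by simp⟩

theorem mem_claimCone_of_mem {l : X → ℝ} (hl : l ∈ L) : l ∈ claimCone μ 𝔾 L e g :=
  ⟨l, hl, fun _ => 0, fun _ => 0, fun _ _ _ => 0, fun _ => le_rfl, fun _ => isExercise_zero,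
    ae_of_all _ fun x => by simp [optionPayoff]⟩

theorem european_mem_claimCone (hL : IsModuleOver m₀ L) (i : ι) : e i ∈ claimCone μ 𝔾 L e g := by
  classical
  refine ⟨_, hL.zero_mem, Pi.single i 1, fun _ => 0, fun _ _ _ => 0, fun k => ?_,
    fun _ => isExercise_zero, ae_of_all _ fun x => ?_⟩
  · rcases eq_or_ne k i with rfl | h <;> simp [*]
  · simp [optionPayoff, Pi.single_apply]

theorem american_mem_claimCone (hL : IsModuleOver m₀ L) (j : κ) {η : Fin (T + 1) → X → ℝ}
    (hη : IsExercise 𝔾 1 η) : (fun x => ∑ t, g j t x * η t x) ∈ claimCone μ 𝔾 L e g := by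
  classical
  refine ⟨_, hL.zero_mem, fun _ => 0, fun k => if k = j then 1 else 0,
    fun k => if k = j then η else fun _ _ => 0, fun _ => le_rfl, fun k => ?_,
    ae_of_all _ fun x => ?_⟩
  · dsimp only
    split_ifs
    · exact hη
    · exact isExercise_zero
  · simp only [optionPayoff, zero_mul, Finset.sum_const_zero, zero_add]
    rw [Finset.sum_eq_single j]
    · simp
    · intro k _ hk
      simp [hk]
    · simp

/-- The risk property removes the options from a hedge of a nonnegative claim; what is left is a
nonnegative element of `L`, which vanishes. -/
theorem arbitrageFree_claimCone (hNA : ArbitrageFree μ L) (hrisk : OptionsAtRisk μ 𝔾 L e g) :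
    ArbitrageFree μ (claimCone μ 𝔾 L e g) := by
  rintro Y ⟨l, hl, a, b, η, ha, hη, hle⟩ hY
  obtain ⟨h1, h2⟩ := hrisk l hl a b η ha hη (by
    filter_upwards [hle, hY] with x hx hx' using hx'.trans hx)
  have hη0 : ∀ j t x, η j t x = 0 := fun j t x =>
    le_antisymm (((hη j).le t x).trans (h2 j).le) ((hη j).nonneg t x)
  have hle' : ∀ᵐ x ∂μ, Y x ≤ l x := by
    filter_upwards [hle] with x hx
    simpa [optionPayoff, h1, hη0] using hx
  have hl0 := hNA l hl (by filter_upwards [hle', hY] with x hx hx' using hx'.trans hx)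
  filter_upwards [hle', hY, hl0] with x h3 h4 h5
  exact le_antisymm (h3.trans h5.le) h4

end OptionMembership

section Existence

variable {ι κ : Type*} [Fintype ι] [Fintype κ] {S : Fin (T + 1) → X → EuclideanSpace ℝ (Fin d)}
  {e : ι → X → ℝ} {g : κ → Fin (T + 1) → X → ℝ}

/-- The normalised Kreps–Yan functional of the claim cone is the density of `Q`. Each property of
`Q` comes from testing it on one kind of element of the cone: a one-period bet, a European claim, an
exercised American claim. Square integrability puts these test elements in the reach of the
functional. -/
theorem exists_martingaleMeasure_of_memLp {ν : Measure X} [IsFiniteMeasure ν] [NeZero ν]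
    (hS : StronglyAdapted 𝔾 S) (hS2 : ∀ t, MemLp (S t) 2 ν) (he : ∀ i, MemLp (e i) 2 ν)
    (hg : ∀ j t, MemLp (g j t) 2 ν) (hNA : ArbitrageFree ν (gains 𝔾 S))
    (hrisk : OptionsAtRisk ν 𝔾 (gains 𝔾 S) e g) :
    ∃ Q : Measure X, IsProbabilityMeasure Q ∧ Q ≪ ν ∧ ν ≪ Q ∧ Martingale S 𝔾 Q ∧
      (∀ i, ∫ x, e i x ∂Q ≤ 0) ∧
      ∀ j η, IsExercise 𝔾 1 η → ∫ x, ∑ t, g j t x * η t x ∂Q ≤ 0 := by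
  have hL := isModuleOver_gains (𝔾 := 𝔾) S
  obtain ⟨Z, hZm, hZ2, hZpos, hZ⟩ := kreps_yan (μ := ν) (C := claimCone ν 𝔾 (gains 𝔾 S) e g)
    (fun Y hY W hW => claimCone_add hL hY hW) (fun c hc Y hY => claimCone_smul hL hc hY)
    (fun Y ⟨l, hl, a, b, η, ha, hη, hle⟩ W hW => ⟨l, hl, a, b, η, ha, hη, by
      filter_upwards [hle, hW] with x hx hx' using hx'.trans hx⟩)
    (mem_claimCone_of_mem hL.zero_mem) (aeclosed_claimCone hL (aeclosed_dominated_gains hNA) hrisk)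
    (arbitrageFree_claimCone hNA hrisk)
  have hZint : Integrable Z ν := hZ2.integrable one_le_two
  have hZnn : 0 ≤ᵐ[ν] Z := hZpos.mono fun x hx => hx.le
  have hIpos : 0 < ∫ x, Z x ∂ν := by
    refine (integral_nonneg_of_ae hZnn).lt_of_ne' fun h => ?_
    rw [integral_eq_zero_iff_of_nonneg_ae hZnn hZint] at h
    obtain ⟨x, hx, hx'⟩ := (hZpos.and h).exists
    exact hx.ne' hx'
  set c := (∫ x, Z x ∂ν)⁻¹ with hc
  have hcpos : 0 < c := inv_pos.2 hIpos
  let D : X → ENNReal := fun x => ENNReal.ofReal (c * Z x)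
  have hDm : Measurable D := (hZm.measurable.const_mul c).ennreal_ofReal
  have hDtop : ∀ᵐ x ∂ν, D x < ⊤ := ae_of_all _ fun x => ENNReal.ofReal_lt_top
  have hDreal : ∀ᵐ x ∂ν, (D x).toReal = c * Z x := by
    filter_upwards [hZpos] with x hx
    exact ENNReal.toReal_ofReal (by positivity)
  let Q := ν.withDensity D
  have hQprob : IsProbabilityMeasure Q := ⟨by
    rw [withDensity_apply _ MeasurableSet.univ, Measure.restrict_univ,
      ← ofReal_integral_eq_lintegral_ofReal (hZint.const_mul c)
        (hZpos.mono fun x hx => by simp only [Pi.zero_apply]; positivity), integral_const_mul,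
      hc, inv_mul_cancel₀ hIpos.ne', ENNReal.ofReal_one]⟩
  have hQint : ∀ f : X → ℝ, ∫ x, f x ∂Q = c * ∫ x, Z x * f x ∂ν := by
    intro f
    rw [integral_withDensity_eq_integral_toReal_smul hDm hDtop, ← integral_const_mul]
    refine integral_congr_ae ?_
    filter_upwards [hDreal] with x hx
    rw [hx, smul_eq_mul, mul_assoc]
  have hneg : ∀ Y ∈ claimCone ν 𝔾 (gains 𝔾 S) e g, MemLp Y 2 ν → ∫ x, Y x ∂Q ≤ 0 := by
    intro Y hY hY2
    rw [hQint]
    exact mul_nonpos_of_nonneg_of_nonpos hcpos.le (hZ Y hY hY2)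
  have hSint : ∀ t, Integrable (S t) Q := by
    intro t
    rw [integrable_withDensity_iff_integrable_smul' hDm hDtop]
    have h1 : Integrable (fun x => c • (Z x • S t x)) ν :=
      ((hS2 t).smul hZ2 (r := 1)).integrable le_rfl |>.smul c
    refine h1.congr ?_
    filter_upwards [hDreal] with x hx
    rw [hx, smul_smul]
  refine ⟨Q, hQprob, withDensity_absolutelyContinuous _ _,
    withDensity_absolutelyContinuous' hDm.aemeasurable (hZpos.mono fun x hx => ?_),
    martingale_of_condExp_succ hS hSint fun u => ?_, fun i => ?_, fun j η hη => ?_⟩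
  · exact (ENNReal.ofReal_pos.2 (mul_pos hcpos hx)).ne'
  · refine ae_eq_condExp_of_forall_setIntegral_eq (𝔾.le _) (hSint _)
      (fun A _ _ => (hSint _).integrableOn) (fun A hA _ => ?_) (hS _).aestronglyMeasurable
    have hA' := 𝔾.le _ A hA
    have hdiff : Integrable (fun x => S u.succ x - S u.castSucc x) (Q.restrict A) :=
      ((hSint _).sub (hSint _)).integrableOn
    have hle : ∀ v, inner ℝ v (∫ x in A, (S u.succ x - S u.castSucc x) ∂Q) ≤ 0 := by
      intro v
      have h1 := hneg _ (mem_claimCone_of_mem (indicator_inner_mem_gains S u hA v))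
        ((((hS2 u.succ).sub (hS2 u.castSucc)).const_inner v).indicator hA')
      rwa [integral_indicator hA', integral_inner hdiff] at h1
    -- The direction `v` is taken to be the integral itself.
    have h0 : ∫ x in A, (S u.succ x - S u.castSucc x) ∂Q = 0 :=
      real_inner_self_nonpos.1 (hle _)
    rw [integral_sub (hSint _).integrableOn (hSint _).integrableOn] at h0
    exact (sub_eq_zero.1 h0).symm
  · exact hneg _ (european_mem_claimCone hL i) (he i)
  · refine hneg _ (american_mem_claimCone hL j hη) (memLp_finsetSum _ fun t _ => ?_)
    refine (hg j t).of_le ((hg j t).aestronglyMeasurable.mul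
      ((hη.measurable t).mono (𝔾.le t) le_rfl).aestronglyMeasurable) (ae_of_all _ fun x => ?_)
    rw [norm_mul]
    refine mul_le_of_le_one_right (norm_nonneg _) ?_
    rw [Real.norm_of_nonneg (hη.nonneg t x)]
    exact hη.le t x

/-- The fundamental theorem of asset pricing for bounded options, in the form of existence of an
equivalent martingale measure that prices the options conservatively. -/
theorem exists_martingaleMeasure {μ : Measure X} [IsFiniteMeasure μ] [NeZero μ]
    (hS : StronglyAdapted 𝔾 S) (he : ∀ i, Measurable (e i)) {C : ℝ} (heC : ∀ i x, |e i x| ≤ C)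
    (hg : ∀ j t, Measurable (g j t)) (hgC : ∀ j t x, |g j t x| ≤ C)
    (hNA : ArbitrageFree μ (gains 𝔾 S)) (hrisk : OptionsAtRisk μ 𝔾 (gains 𝔾 S) e g) :
    ∃ Q : Measure X, IsProbabilityMeasure Q ∧ Q ≪ μ ∧ μ ≪ Q ∧ Martingale S 𝔾 Q ∧
      (∀ i, ∫ x, e i x ∂Q ≤ 0) ∧
      ∀ j η, IsExercise 𝔾 1 η → ∫ x, ∑ t, g j t x * η t x ∂Q ≤ 0 := by
  have hSm : ∀ t, StronglyMeasurable (S t) := fun t => (hS t).mono (𝔾.le t)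
  -- The density `r ^ 2` makes all prices square integrable under an equivalent finite measure; the
  -- hypotheses and the conclusion depend on `μ` only through its null sets.
  let r : X → ℝ := fun x => (1 + ∑ t, ‖S t x‖)⁻¹
  have hsum : ∀ x, 0 ≤ ∑ t, ‖S t x‖ := fun x => Finset.sum_nonneg fun t _ => norm_nonneg _
  have hr0 : ∀ x, 0 < r x := fun x => inv_pos.2 (by linarith [hsum x])
  have hr1 : ∀ x, r x ≤ 1 := fun x => inv_le_one_of_one_le₀ (by linarith [hsum x])
  have hrS : ∀ t x, r x * ‖S t x‖ ≤ 1 := fun t x => by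
    rw [inv_mul_le_iff₀ (by linarith [hsum x]), mul_one]
    linarith [Finset.single_le_sum (fun t _ => norm_nonneg (S t x)) (Finset.mem_univ t)]
  have hrm : Measurable r :=
    (measurable_const.add (Finset.measurable_sum _ fun t _ => (hSm t).norm.measurable)).inv
  let D : X → ENNReal := fun x => ENNReal.ofReal (r x ^ 2)
  have hDm : Measurable D := (hrm.pow_const 2).ennreal_ofReal
  let ν := μ.withDensity D
  have hνμ : ν ≪ μ := withDensity_absolutelyContinuous _ _
  have hμν : μ ≪ ν := withDensity_absolutelyContinuous' hDm.aemeasurable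
    (ae_of_all _ fun x => (ENNReal.ofReal_pos.2 (pow_pos (hr0 x) 2)).ne')
  have hνfin : IsFiniteMeasure ν := by
    refine isFiniteMeasure_withDensity_ofReal (Integrable.of_bound
      (hrm.pow_const 2).aestronglyMeasurable 1 (ae_of_all _ fun x => ?_)).2
    rw [Real.norm_of_nonneg (by positivity)]
    exact pow_le_one₀ (hr0 x).le (hr1 x)
  have hν0 : NeZero ν := ⟨fun h => NeZero.ne μ (Measure.measure_univ_eq_zero.1 (hμν (by simp [h])))⟩
  have hS2 : ∀ t, MemLp (S t) 2 ν := by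
    intro t
    rw [memLp_two_iff_integrable_sq_norm (hSm t).aestronglyMeasurable,
      integrable_withDensity_iff_integrable_smul' hDm (ae_of_all _ fun x => ENNReal.ofReal_lt_top)]
    refine Integrable.of_bound (hDm.ennreal_toReal.smul
      ((hSm t).norm.measurable.pow_const 2)).aestronglyMeasurable 1 (ae_of_all _ fun x => ?_)
    rw [ENNReal.toReal_ofReal (by positivity), smul_eq_mul, ← mul_pow,
      Real.norm_of_nonneg (by positivity)]
    exact pow_le_one₀ (mul_nonneg (hr0 x).le (norm_nonneg _)) (hrS t x)
  obtain ⟨Q, hQ, hQν, hνQ, hrest⟩ := exists_martingaleMeasure_of_memLp (ν := ν) hS hS2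
    (fun i => MemLp.of_bound (he i).aestronglyMeasurable C (ae_of_all _ (heC i)))
    (fun j t => MemLp.of_bound (hg j t).aestronglyMeasurable C (ae_of_all _ (hgC j t)))
    (fun l hl h => hνμ.ae_le (hNA l hl (hμν.ae_le h)))
    (fun l hl a b η ha hη h => hrisk l hl a b η ha hη (hμν.ae_le h))
  exact ⟨Q, hQ, hQν.trans hνμ, hμν.trans hνQ, hrest⟩

end Existence

end MartingaleMeasure

/-! ### Absence of arbitrage from a martingale measure. -/

section NoArbitrageOfMartingale

variable {X : Type*} {mX : MeasurableSpace X} {T d : ℕ} {𝔾 : Filtration (Fin (T + 1)) mX}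
  {ι κ : Type*} [Fintype ι] [Fintype κ] {S : Fin (T + 1) → X → EuclideanSpace ℝ (Fin d)}
  {e : ι → X → ℝ} {g : κ → Fin (T + 1) → X → ℝ}

theorem measurable_optionPayoff (he : ∀ i, Measurable (e i)) (hg : ∀ j t, Measurable (g j t))
    (a : ι → ℝ) {η : κ → Fin (T + 1) → X → ℝ} (hη : ∀ j t, Measurable (η j t)) :
    Measurable (optionPayoff e g a η) :=
  (Finset.measurable_sum _ fun i _ => (he i).const_mul _).add
    (Finset.measurable_sum _ fun j _ => Finset.measurable_sum _ fun t _ => (hg j t).mul (hη j t))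

theorem abs_optionPayoff_le {C : ℝ} (heC : ∀ i x, |e i x| ≤ C) (hgC : ∀ j t x, |g j t x| ≤ C)
    (a : ι → ℝ) {b : κ → ℝ} {η : κ → Fin (T + 1) → X → ℝ} (hη : ∀ j, IsExercise 𝔾 (b j) (η j))
    (x : X) : |optionPayoff e g a η x| ≤ ∑ i, |a i| * C + ∑ j, C * b j := by
  refine (abs_add_le _ _).trans (add_le_add ?_ ?_)
  · refine (Finset.abs_sum_le_sum_abs _ _).trans (Finset.sum_le_sum fun i _ => ?_)
    rw [abs_mul]
    exact mul_le_mul_of_nonneg_left (heC i x) (abs_nonneg _)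
  · refine (Finset.abs_sum_le_sum_abs _ _).trans (Finset.sum_le_sum fun j _ => ?_)
    rw [← (hη j).sum_eq x, Finset.mul_sum]
    refine (Finset.abs_sum_le_sum_abs _ _).trans (Finset.sum_le_sum fun t _ => ?_)
    rw [abs_mul, abs_of_nonneg ((hη j).nonneg t x)]
    exact mul_le_mul_of_nonneg_right (hgC j t x) ((hη j).nonneg t x)

/-- An equivalent martingale measure that prices the options conservatively excludes arbitrage. -/
theorem payoff_ae_eq_zero {Q : Measure X} [IsFiniteMeasure Q] (hS : Martingale S 𝔾 Q)
    (he : ∀ i, Measurable (e i)) {C : ℝ} (heC : ∀ i x, |e i x| ≤ C)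
    (hg : ∀ j t, Measurable (g j t)) (hgC : ∀ j t x, |g j t x| ≤ C)
    (heQ : ∀ i, ∫ x, e i x ∂Q ≤ 0)
    (hgQ : ∀ j (τ : X → Fin (T + 1)), IsStoppingTime 𝔾 (fun x => (τ x : WithTop (Fin (T + 1)))) →
      ∫ x, g j (τ x) x ∂Q ≤ 0)
    {l : X → ℝ} (hl : l ∈ gains 𝔾 S) {a : ι → ℝ} (ha : ∀ i, 0 ≤ a i) {b : κ → ℝ}
    (hb : ∀ j, 0 ≤ b j) {η : κ → Fin (T + 1) → X → ℝ} (hη : ∀ j, IsExercise 𝔾 1 (η j))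
    (hpay : ∀ᵐ x ∂Q, 0 ≤ l x + optionPayoff e g a (fun j t x => b j * η j t x) x) :
    ∀ᵐ x ∂Q, l x + optionPayoff e g a (fun j t x => b j * η j t x) x = 0 := by
  obtain ⟨H, hH, rfl⟩ := hl
  have hηm : ∀ j t, Measurable (η j t) := fun j t => ((hη j).measurable t).mono (𝔾.le t) le_rfl
  have hbη : ∀ j, IsExercise 𝔾 (b j * 1) (fun t x => b j * η j t x) := fun j =>
    (hη j).smul (hb j)
  have hbd := abs_optionPayoff_le heC hgC a hbη
  have hWint : Integrable (optionPayoff e g a (fun j t x => b j * η j t x)) Q :=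
    Integrable.of_bound (measurable_optionPayoff he hg a
      fun j t => (hηm j t).const_mul _).aestronglyMeasurable _ (ae_of_all _ hbd)
  -- The total payoff is nonnegative and the options pay at most the constant `c`, so the gains are
  -- at least `-c`.
  obtain ⟨hVint, hV⟩ := integral_gains_nonpos hS hH
    (c := ∑ i, |a i| * C + ∑ j, C * (b j * 1)) (by
      filter_upwards [hpay] with x hx
      have := (abs_le.1 (hbd x)).2
      linarith)
  have heint : ∀ i, Integrable (e i) Q := fun i =>
    Integrable.of_bound (he i).aestronglyMeasurable C (ae_of_all _ (heC i))
  have hgint : ∀ j t, Integrable (fun x => g j t x * (b j * η j t x)) Q := fun j t => by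
    refine Integrable.of_bound ((hg j t).mul ((hηm j t).const_mul _)).aestronglyMeasurable
      (C * (b j * 1)) (ae_of_all _ fun x => ?_)
    rw [norm_mul]
    refine mul_le_mul (hgC j t x) ?_ (norm_nonneg _) ((abs_nonneg _).trans (hgC j t x))
    rw [Real.norm_of_nonneg ((hbη j).nonneg t x)]
    exact (hbη j).le t x
  have hW : ∫ x, optionPayoff e g a (fun j t x => b j * η j t x) x ∂Q ≤ 0 := by
    simp only [optionPayoff]
    rw [integral_add (integrable_finsetSum _ fun i _ => (heint i).const_mul _)
      (integrable_finsetSum _ fun j _ => integrable_finsetSum _ fun t _ => hgint j t),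
      integral_finsetSum _ fun i _ => (heint i).const_mul _,
      integral_finsetSum _ fun j _ => integrable_finsetSum _ fun t _ => hgint j t]
    refine add_nonpos (Finset.sum_nonpos fun i _ => ?_) (Finset.sum_nonpos fun j _ => ?_)
    · rw [integral_const_mul]
      exact mul_nonpos_of_nonneg_of_nonpos (ha i) (heQ i)
    · have h1 : ∀ x, ∑ t, g j t x * (b j * η j t x) = b j * ∑ t, g j t x * η j t x := fun x => by
        rw [Finset.mul_sum]
        exact Finset.sum_congr rfl fun t _ => by ring
      simp only [h1]
      rw [integral_const_mul]
      exact mul_nonpos_of_nonneg_of_nonpos (hb j)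
        (integral_exercise_le (hg j) (hgC j) (hgQ j) (hη j))
  have hsum := integral_add hVint hWint
  have h0 := le_antisymm (hsum.le.trans (add_nonpos hV hW)) (integral_nonneg_of_ae hpay)
  exact (integral_eq_zero_iff_of_nonneg_ae hpay (hVint.add hWint)).1 h0

end NoArbitrageOfMartingale

/-! ### Stopping times and liquidating strategies as exercise strategies. -/

section Stopping

variable {X : Type*} {mX : MeasurableSpace X} {T : ℕ} {𝔾 : Filtration (Fin (T + 1)) mX}

theorem isExercise_of_isStoppingTime {τ : X → Fin (T + 1)}
    (hτ : IsStoppingTime 𝔾 (fun x => (τ x : WithTop (Fin (T + 1))))) :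
    IsExercise 𝔾 1 (fun t x => if τ x = t then 1 else 0) where
  measurable t := by
    refine Measurable.ite ?_ measurable_const measurable_const
    simpa using hτ.measurableSet_eq t
  nonneg t x := by split_ifs <;> norm_num
  sum_eq x := by simp

theorem isLiquidatingStrategy_iff {η : Fin (T + 1) → X → ℝ} :
    IsLiquidatingStrategy 𝔾 η ↔ IsExercise 𝔾 1 η :=
  ⟨fun h => ⟨fun t => (h.1 t).measurable, h.2.1, h.2.2⟩,
    fun h => ⟨fun t => (h.measurable t).stronglyMeasurable, h.nonneg, h.sum_eq⟩⟩

/-- An exercise strategy is a multiple of a liquidating strategy. -/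
theorem IsExercise.exists_eq_mul {b : ℝ} (hb : 0 ≤ b) {η : Fin (T + 1) → X → ℝ}
    (h : IsExercise 𝔾 b η) : ∃ ν, IsExercise 𝔾 1 ν ∧ ∀ t x, η t x = b * ν t x := by
  rcases hb.eq_or_lt with rfl | hb
  · exact ⟨_, isExercise_of_isStoppingTime (isStoppingTime_const 𝔾 (Fin.last T)), fun t x => by
      rw [zero_mul]; exact le_antisymm (h.le t x) (h.nonneg t x)⟩
  · refine ⟨fun t x => b⁻¹ * η t x, ?_, fun t x => by rw [mul_inv_cancel_left₀ hb.ne']⟩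
    have := h.smul (inv_nonneg.2 hb.le)
    rwa [inv_mul_cancel₀ hb.ne'] at this

end Stopping

/-! ### Application to the enlarged space. -/

section Enlarged

variable {Ω : Type*} [mΩ : MeasurableSpace Ω] {T d L M N n : ℕ}

theorem measurable_outcome (𝔽 : Filtration (Fin (T + 1)) mΩ) (n : ℕ) (t : Fin (T + 1)) :
    Measurable[enlargedFiltration 𝔽 n t, 𝔽 t]
      (EnlargedSpace.outcome : EnlargedSpace 𝔽 n → Ω) :=
  measurable_iff_comap_le.2 le_sup_left

theorem measurable_exercise (𝔽 : Filtration (Fin (T + 1)) mΩ) (k : Fin n) :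
    Measurable (fun x : EnlargedSpace 𝔽 n => x.exercise k) := by
  have hle : ∀ s : Fin (T + 1), MeasurableSet {x : EnlargedSpace 𝔽 n | x.exercise k ≤ s} := fun s =>
    (le_sup_right : _ ≤ enlargedSigma 𝔽 n (Fin.last T)) _
      (MeasurableSpace.measurableSet_generateFrom ⟨k, s, Fin.le_last s, rfl⟩)
  refine measurable_to_countable' fun s => ?_
  have : (fun x : EnlargedSpace 𝔽 n => x.exercise k) ⁻¹' {s} =
      {x | x.exercise k ≤ s} \ ⋃ r ∈ Set.Iio s, {x | x.exercise k ≤ r} := by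
    ext x
    simp only [Set.mem_preimage, Set.mem_singleton_iff, Set.mem_sdiff, Set.mem_ofPred_eq,
      Set.mem_iUnion, Set.mem_Iio, exists_prop, not_exists, not_and, not_le]
    exact ⟨fun h => ⟨h.le, fun r hr => h ▸ hr⟩, fun h => h.1.eq_of_not_lt fun hlt =>
      lt_irrefl _ (h.2 _ hlt)⟩
  rw [this]
  exact (hle s).diff (MeasurableSet.biUnion (Set.to_countable _) fun r _ => hle r)

theorem exists_forall_abs_le {ι X : Type*} [Finite ι] {u : ι → X → ℝ}
    (h : ∀ i, ∃ C, ∀ x, |u i x| ≤ C) : ∃ C, ∀ i x, |u i x| ≤ C := by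
  choose C hC using h
  obtain ⟨D, hD⟩ := (Set.finite_range C).bddAbove
  exact ⟨D, fun i x => (hC i x).trans (hD ⟨i, rfl⟩)⟩

variable (𝓜 : Market Ω T d L M N)

theorem stronglyAdapted_enlS : StronglyAdapted (enlargedFiltration 𝓜.filt n) (𝓜.enlS n) :=
  fun t => (𝓜.S_adapted t).comp_measurable (measurable_outcome 𝓜.filt n t)

theorem measurable_enlF (i : Fin L) : Measurable (𝓜.enlF n i) :=
  (𝓜.f_measurable i).measurable.comp (measurable_outcome 𝓜.filt n (Fin.last T))

theorem measurable_enlG (j : Fin M) (t : Fin (T + 1)) : Measurable (𝓜.enlG n j t) :=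
  ((𝓜.g_adapted j t).measurable.comp (measurable_outcome 𝓜.filt n t)).mono
    ((enlargedFiltration 𝓜.filt n).le t) le_rfl

theorem measurable_enlH (hNn : N ≤ n) (k : Fin N) : Measurable (𝓜.enlH hNn k) := by
  have h : Measurable (fun p : Fin (T + 1) × EnlargedSpace 𝓜.filt n => 𝓜.h k p.1 p.2.outcome) :=
    measurable_from_prod_countable_right fun s =>
      ((𝓜.h_adapted k s).measurable.comp (measurable_outcome 𝓜.filt n s)).mono
        ((enlargedFiltration 𝓜.filt n).le s) le_rfl
  exact h.comp ((measurable_exercise 𝓜.filt (Fin.castLE hNn k)).prodMk measurable_id)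

/-- The net payoffs of the European options and of the shorted American options, at prices that
are less favourable to the seller by `δ`. -/
def netEuropean (hNn : N ≤ n) (α : Fin L → ℝ) (γ : Fin N → ℝ) (δ : ℝ) :
    Fin L ⊕ Fin N → EnlargedSpace 𝓜.filt n → ℝ :=
  Sum.elim (fun i x => 𝓜.enlF n i x - (α i - δ)) (fun k x => (γ k + δ) - 𝓜.enlH hNn k x)

/-- The net payoffs of the American options bought at the prices `β - δ`. -/
def netAmerican (n : ℕ) (β : Fin M → ℝ) (δ : ℝ) (j : Fin M) (t : Fin (T + 1))
    (x : EnlargedSpace 𝓜.filt n) : ℝ :=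
  𝓜.enlG n j t x - (β j - δ)

theorem measurable_netEuropean (hNn : N ≤ n) (α : Fin L → ℝ) (γ : Fin N → ℝ) (δ : ℝ) :
    ∀ i, Measurable (netEuropean 𝓜 hNn α γ δ i)
  | Sum.inl i => (measurable_enlF 𝓜 i).sub_const _
  | Sum.inr k => (measurable_enlH 𝓜 hNn k).const_sub _

theorem measurable_netAmerican (β : Fin M → ℝ) (δ : ℝ) (j : Fin M) (t : Fin (T + 1)) :
    Measurable (netAmerican 𝓜 n β δ j t) :=
  (measurable_enlG 𝓜 j t).sub_const _

theorem exists_bound_net (hNn : N ≤ n) (α : Fin L → ℝ) (β : Fin M → ℝ) (γ : Fin N → ℝ) (δ : ℝ) :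
    ∃ C, (∀ i x, |netEuropean 𝓜 hNn α γ δ i x| ≤ C) ∧
      ∀ j t x, |netAmerican 𝓜 n β δ j t x| ≤ C := by
  obtain ⟨Cf, hCf⟩ := 𝓜.f_bounded
  obtain ⟨Cg, hCg⟩ := 𝓜.g_bounded
  obtain ⟨Ch, hCh⟩ := 𝓜.h_bounded
  obtain ⟨C₁, hC₁⟩ := exists_forall_abs_le (u := netEuropean 𝓜 hNn α γ δ) (by
    rintro (i | k)
    · exact ⟨Cf + |α i - δ|, fun x => (abs_sub _ _).trans (add_le_add_left (hCf i _) _)⟩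
    · exact ⟨|γ k + δ| + Ch, fun x => (abs_sub _ _).trans (add_le_add_right (hCh k _ _) _)⟩)
  obtain ⟨C₂, hC₂⟩ := exists_forall_abs_le
    (u := fun (p : Fin M × Fin (T + 1)) => netAmerican 𝓜 n β δ p.1 p.2) fun p =>
      ⟨Cg + |β p.1 - δ|, fun x => (abs_sub _ _).trans (add_le_add_left (hCg p.1 p.2 _) _)⟩
  exact ⟨max C₁ C₂, fun i x => (hC₁ i x).trans (le_max_left _ _),
    fun j t x => (hC₂ (j, t) x).trans (le_max_right _ _)⟩

/-- Liquidating weights add up to `1`, so the price of an American option can be subtracted from its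
payoff at each date. A sale is a purchase of the claim with opposite sign. -/
theorem payoff_eq (hNn : N ≤ n) (α : Fin L → ℝ) (β : Fin M → ℝ) (γ : Fin N → ℝ) (δ : ℝ)
    (A : 𝓜.Strategy n) (x : EnlargedSpace 𝓜.filt n) :
    𝓜.payoff hNn (fun i => α i - δ) (fun j => β j - δ) (fun k => γ k + δ) A x =
      ∑ t : Fin T, inner ℝ (A.H t.castSucc x) (𝓜.enlS n t.succ x - 𝓜.enlS n t.castSucc x) +
      optionPayoff (netEuropean 𝓜 hNn α γ δ) (netAmerican 𝓜 n β δ) (Sum.elim A.a A.c)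
        (fun j t x => A.b j * A.μ j t x) x := by
  have hμ : ∀ j, ∑ t, netAmerican 𝓜 n β δ j t x * (A.b j * A.μ j t x) =
      A.b j * ((∑ t, 𝓜.enlG n j t x * A.μ j t x) - (β j - δ)) := by
    intro j
    have h1 : β j - δ = ∑ t, (β j - δ) * A.μ j t x := by
      rw [← Finset.mul_sum, (A.μ_liquidating j).2.2 x, mul_one]
    rw [h1, ← Finset.sum_sub_distrib, Finset.mul_sum]
    refine Finset.sum_congr rfl fun t _ => ?_
    simp only [netAmerican]
    ring
  simp only [Market.payoff, optionPayoff, hμ, Fintype.sum_sum_type, Sum.elim_inl, Sum.elim_inr,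
    netEuropean]
  have hc : ∑ k, A.c k * (γ k + δ - 𝓜.enlH hNn k x) =
      -∑ k, A.c k * (𝓜.enlH hNn k x - (γ k + δ)) := by
    rw [← Finset.sum_neg_distrib]
    exact Finset.sum_congr rfl fun k _ => by ring
  rw [hc]
  ring

/-- Every unit of option held gains the same constant `ε - δ`, an American unit because its exercise
weights sum to its size. -/
theorem optionPayoff_net_sub (hNn : N ≤ n) (α : Fin L → ℝ) (β : Fin M → ℝ) (γ : Fin N → ℝ)
    (δ ε : ℝ) (a : Fin L ⊕ Fin N → ℝ) {b : Fin M → ℝ}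
    {η : Fin M → Fin (T + 1) → EnlargedSpace 𝓜.filt n → ℝ}
    (hη : ∀ j, IsExercise (enlargedFiltration 𝓜.filt n) (b j) (η j))
    (x : EnlargedSpace 𝓜.filt n) :
    optionPayoff (netEuropean 𝓜 hNn α γ ε) (netAmerican 𝓜 n β ε) a η x =
      optionPayoff (netEuropean 𝓜 hNn α γ δ) (netAmerican 𝓜 n β δ) a η x +
        (ε - δ) * (∑ i, a i + ∑ j, b j) := by
  have h1 : ∀ i, netEuropean 𝓜 hNn α γ ε i x = netEuropean 𝓜 hNn α γ δ i x + (ε - δ) := by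
    rintro (i | k) <;> simp only [netEuropean, Sum.elim_inl, Sum.elim_inr] <;> ring
  have h2 : ∀ j t, netAmerican 𝓜 n β ε j t x = netAmerican 𝓜 n β δ j t x + (ε - δ) := by
    intro j t
    simp only [netAmerican]
    ring
  simp only [optionPayoff, h1, h2, mul_add, add_mul, Finset.sum_add_distrib, ← Finset.mul_sum,
    ← Finset.sum_mul, (hη _).sum_eq]
  ring

section NoArbitrage

variable {𝓜} {hNn : N ≤ n} {Pbar : Measure (EnlargedSpace 𝓜.filt n)} {α : Fin L → ℝ}
  {β : Fin M → ℝ} {γ : Fin N → ℝ} {ε : ℝ}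

theorem noArbitrage_iff :
    𝓜.NoArbitrage hNn Pbar (fun i => α i - ε) (fun j => β j - ε) (fun k => γ k + ε) ↔
      ∀ l ∈ gains (enlargedFiltration 𝓜.filt n) (𝓜.enlS n), ∀ (a : Fin L ⊕ Fin N → ℝ)
        (b : Fin M → ℝ) (η : Fin M → Fin (T + 1) → EnlargedSpace 𝓜.filt n → ℝ), (∀ i, 0 ≤ a i) → (∀ j, 0 ≤ b j) →
        (∀ j, IsExercise (enlargedFiltration 𝓜.filt n) 1 (η j)) →
        (∀ᵐ x ∂Pbar, 0 ≤ l x + optionPayoff (netEuropean 𝓜 hNn α γ ε) (netAmerican 𝓜 n β ε) a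
          (fun j t x => b j * η j t x) x) →
        ∀ᵐ x ∂Pbar, l x + optionPayoff (netEuropean 𝓜 hNn α γ ε) (netAmerican 𝓜 n β ε) a
          (fun j t x => b j * η j t x) x = 0 := by
  constructor
  · rintro h _ ⟨H, hH, rfl⟩ a b η ha hb hη hpay
    have := h ⟨H, hH, fun i => a (Sum.inl i), fun i => ha _, b, hb, η,
      fun j => isLiquidatingStrategy_iff.2 (hη j), fun k => a (Sum.inr k), fun k => ha _⟩
    simp only [payoff_eq] at this
    have ha' : Sum.elim (fun i => a (Sum.inl i)) (fun k => a (Sum.inr k)) = a :=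
      Sum.elim_comp_inl_inr a
    rw [ha'] at this
    exact this hpay
  · intro h A hA
    simp only [payoff_eq] at hA ⊢
    exact h _ ⟨A.H, A.H_adapted, rfl⟩ _ _ _ (by
      rintro (i | k)
      · exact A.a_nonneg i
      · exact A.c_nonneg k) A.b_nonneg (fun j => isLiquidatingStrategy_iff.1 (A.μ_liquidating j)) hA

theorem arbitrageFree_gains_of_noArbitrage
    (h : 𝓜.NoArbitrage hNn Pbar (fun i => α i - ε) (fun j => β j - ε) (fun k => γ k + ε)) :
    ArbitrageFree Pbar (gains (enlargedFiltration 𝓜.filt n) (𝓜.enlS n)) := by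
  intro l hl hpos
  have := noArbitrage_iff.1 h l hl (fun _ => 0) (fun _ => 0) _ (fun _ => le_rfl) (fun _ => le_rfl)
    fun _ => isExercise_of_isStoppingTime (isStoppingTime_const _ (Fin.last T))
  simpa [optionPayoff] using this (by simpa [optionPayoff] using hpos)

/-- A position hedged without loss at margin `δ` earns at least `(ε - δ) * (∑ a + ∑ b)` at margin
`ε`, where NA forces the payoff to be `0`; so both sums vanish. -/
theorem optionsAtRisk_of_noArbitrage [NeZero Pbar] {δ : ℝ} (hδ : δ < ε)
    (h : 𝓜.NoArbitrage hNn Pbar (fun i => α i - ε) (fun j => β j - ε) (fun k => γ k + ε)) :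
    OptionsAtRisk Pbar (enlargedFiltration 𝓜.filt n)
      (gains (enlargedFiltration 𝓜.filt n) (𝓜.enlS n)) (netEuropean 𝓜 hNn α γ δ)
      (netAmerican 𝓜 n β δ) := by
  intro l hl a b η ha hη hpay
  obtain ⟨x₀⟩ : Nonempty (EnlargedSpace 𝓜.filt n) := (ae_neBot.2 (NeZero.ne Pbar)).nonempty
  have hb : ∀ j, 0 ≤ b j := fun j => by
    rw [← (hη j).sum_eq x₀]
    exact Finset.sum_nonneg fun t _ => (hη j).nonneg t x₀
  choose ν hν hην using fun j => (hη j).exists_eq_mul (hb j)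
  have hη' : (fun j t x => b j * ν j t x) = η := by
    ext j t x
    rw [hην]
  have hsa : 0 ≤ ∑ i, a i := Finset.sum_nonneg fun i _ => ha i
  have hsb : 0 ≤ ∑ j, b j := Finset.sum_nonneg fun j _ => hb j
  have h1 := noArbitrage_iff.1 h l hl a b ν ha hb hν
  simp only [hη', optionPayoff_net_sub 𝓜 hNn α β γ δ ε a hη, ← add_assoc] at h1
  have h2 := h1 (by
    filter_upwards [hpay] with x hx
    exact add_nonneg hx (mul_nonneg (sub_nonneg.2 hδ.le) (add_nonneg hsa hsb)))
  obtain ⟨x, hx, hx'⟩ := (hpay.and h2).exists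
  have hsum : ∑ i, a i + ∑ j, b j ≤ 0 := by
    by_contra! hpos
    have := mul_pos (sub_pos.2 hδ) hpos
    linarith
  have hsa0 : ∑ i, a i = 0 := by linarith
  have hsb0 : ∑ j, b j = 0 := by linarith
  exact ⟨fun i => (Finset.sum_eq_zero_iff_of_nonneg fun i _ => ha i).1 hsa0 i (Finset.mem_univ i),
    fun j => (Finset.sum_eq_zero_iff_of_nonneg fun j _ => hb j).1 hsb0 j (Finset.mem_univ j)⟩

theorem integrable_enlG_stopped {Q : Measure (EnlargedSpace 𝓜.filt n)} [IsFiniteMeasure Q]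
    (j : Fin M) {τ : EnlargedSpace 𝓜.filt n → Fin (T + 1)}
    (hτ : IsStoppingTime (enlargedFiltration 𝓜.filt n)
      (fun x => (τ x : WithTop (Fin (T + 1))))) :
    Integrable (fun x => 𝓜.enlG n j (τ x) x) Q := by
  obtain ⟨C, hC⟩ := 𝓜.g_bounded
  have hsum : (fun x => 𝓜.enlG n j (τ x) x) =
      fun x => ∑ t, 𝓜.enlG n j t x * if τ x = t then 1 else 0 := by
    ext x
    simp
  have hm : Measurable (fun x => 𝓜.enlG n j (τ x) x) := by
    rw [hsum]
    exact Finset.measurable_sum _ fun t _ => (measurable_enlG 𝓜 j t).mul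
      (((isExercise_of_isStoppingTime hτ).measurable t).mono
        ((enlargedFiltration 𝓜.filt n).le t) le_rfl)
  exact Integrable.of_bound hm.aestronglyMeasurable C (ae_of_all _ fun x => hC j _ _)

theorem martingaleMeasures_nonempty_of_strictNoArbitrage [IsFiniteMeasure Pbar] [NeZero Pbar]
    (h : 𝓜.StrictNoArbitrage hNn Pbar α β γ) :
    (𝓜.martingaleMeasures hNn Pbar α β γ).Nonempty := by
  obtain ⟨ε, hε, hNA⟩ := h
  -- Half of the margin secures the risk property; the other half makes the inequalities for `Q`
  -- strict.
  obtain ⟨C, heC, hgC⟩ := exists_bound_net 𝓜 hNn α β γ (ε / 2)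
  obtain ⟨Q, hQ, hQP, hPQ, hmart, he, hg⟩ := exists_martingaleMeasure (stronglyAdapted_enlS 𝓜)
    (measurable_netEuropean 𝓜 hNn α γ (ε / 2)) heC (measurable_netAmerican 𝓜 β (ε / 2)) hgC
    (arbitrageFree_gains_of_noArbitrage hNA) (optionsAtRisk_of_noArbitrage (half_lt_self hε) hNA)
  obtain ⟨Cf, hCf⟩ := 𝓜.f_bounded
  obtain ⟨Ch, hCh⟩ := 𝓜.h_bounded
  refine ⟨Q, hQ, hQP, hPQ, hmart, fun i => ?_, fun k => ?_, fun j => ?_⟩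
  · have h1 := he (Sum.inl i)
    simp only [netEuropean, Sum.elim_inl] at h1
    rw [integral_sub (Integrable.of_bound (measurable_enlF 𝓜 i).aestronglyMeasurable Cf
      (ae_of_all _ fun x => hCf i _)) (integrable_const _), integral_const, probReal_univ,
      one_smul] at h1
    linarith
  · have h1 := he (Sum.inr k)
    simp only [netEuropean, Sum.elim_inr] at h1
    rw [integral_sub (integrable_const _) (Integrable.of_bound
      (measurable_enlH 𝓜 hNn k).aestronglyMeasurable Ch (ae_of_all _ fun x => hCh k _ _)),
      integral_const, probReal_univ, one_smul] at h1
    linarith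
  · have : Nonempty (𝓜.StoppingTimes n) :=
      ⟨⟨fun _ => Fin.last T, isStoppingTime_const _ (Fin.last T)⟩⟩
    refine (ciSup_le fun τ => ?_).trans_lt (show β j - ε / 2 < β j by linarith)
    have h1 := hg j _ (isExercise_of_isStoppingTime τ.2)
    simp only [mul_ite, mul_one, mul_zero, Finset.sum_ite_eq, Finset.mem_univ, if_true,
      netAmerican] at h1
    rw [integral_sub (integrable_enlG_stopped j τ.2) (integrable_const _), integral_const,
      probReal_univ, one_smul] at h1
    linarith

theorem strictNoArbitrage_of_martingaleMeasures_nonempty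
    (h : (𝓜.martingaleMeasures hNn Pbar α β γ).Nonempty) :
    𝓜.StrictNoArbitrage hNn Pbar α β γ := by
  obtain ⟨Q, hQ, hQP, hPQ, hmart, hf, hh, hg⟩ := h
  obtain ⟨Cf, hCf⟩ := 𝓜.f_bounded
  obtain ⟨Cg, hCg⟩ := 𝓜.g_bounded
  obtain ⟨Ch, hCh⟩ := 𝓜.h_bounded
  -- Each strict inequality tolerates all small `ε > 0`, and as there are finitely many, one `ε`
  -- serves them all.
  have hsmall : ∀ {p q : ℝ}, p < q → ∀ᶠ ε in 𝓝[>] (0 : ℝ), p ≤ q - ε := fun {p q} hpq => by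
    filter_upwards [Ioo_mem_nhdsGT (sub_pos.2 hpq)] with ε hε
    linarith [hε.2]
  obtain ⟨ε, hεf, hεh, hεg, hε⟩ := ((eventually_all.2 fun i => hsmall (hf i)).and
    ((eventually_all.2 fun k => hsmall (hh k)).and
    ((eventually_all.2 fun j => hsmall (hg j)).and self_mem_nhdsWithin))).exists
  refine ⟨ε, hε, noArbitrage_iff.2 fun l hl a b η ha hb hη hpay => hPQ.ae_le ?_⟩
  obtain ⟨C, heC, hgC⟩ := exists_bound_net 𝓜 hNn α β γ ε
  refine payoff_ae_eq_zero hmart (measurable_netEuropean 𝓜 hNn α γ ε) heC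
    (measurable_netAmerican 𝓜 β ε) hgC ?_ (fun j τ hτ => ?_) hl ha hb hη (hQP.ae_le hpay)
  · rintro (i | k)
    · simp only [netEuropean, Sum.elim_inl]
      rw [integral_sub (Integrable.of_bound (measurable_enlF 𝓜 i).aestronglyMeasurable Cf
        (ae_of_all _ fun x => hCf i _)) (integrable_const _), integral_const, probReal_univ,
        one_smul]
      linarith [hεf i]
    · simp only [netEuropean, Sum.elim_inr]
      rw [integral_sub (integrable_const _) (Integrable.of_bound
        (measurable_enlH 𝓜 hNn k).aestronglyMeasurable Ch (ae_of_all _ fun x => hCh k _ _)),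
        integral_const, probReal_univ, one_smul]
      linarith [hεh k]
  · have hle : ∫ x, 𝓜.enlG n j (τ x) x ∂Q ≤ β j - ε := by
      refine le_trans (le_ciSup (f := fun τ : 𝓜.StoppingTimes n =>
        ∫ x, 𝓜.enlG n j (τ.1 x) x ∂Q) ?_ ⟨τ, hτ⟩) (hεg j)
      -- A real supremum dominates its terms only if the family is bounded above, which follows from
      -- the bound on `g`.
      refine ⟨Cg, ?_⟩
      rintro _ ⟨σ, rfl⟩
      have h1 := norm_integral_le_of_norm_le_const (μ := Q) (f := fun x => 𝓜.enlG n j (σ.1 x) x)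
        (ae_of_all _ fun x => hCg j (σ.1 x) x.outcome)
      rw [probReal_univ, mul_one] at h1
      exact (le_abs_self _).trans h1
    simp only [netAmerican]
    rw [integral_sub (integrable_enlG_stopped j hτ) (integrable_const _), integral_const,
      probReal_univ, one_smul]
    linarith

end NoArbitrage

end Enlarged

end FTAP

theorem theorem2p3 {Ω : Type*} [mΩ : MeasurableSpace Ω] {T d L M N : ℕ}
    (𝓜 : Market Ω T d L M N) (P : Measure Ω) [IsProbabilityMeasure P] [IsSeparable P]
    (α : Fin L → ℝ) (β : Fin M → ℝ) (γ : Fin N → ℝ)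
    (n : ℕ) (hNn : N ≤ n) (hn : n = N ∨ n = N + 1)
    (R : Measure (Fin n → Fin (T + 1))) [IsProbabilityMeasure R] (hR : ∀ t, 0 < R {t}) :
    𝓜.StrictNoArbitrage hNn (enlargedMeasure 𝓜.filt P R) α β γ ↔
      (𝓜.martingaleMeasures hNn (enlargedMeasure 𝓜.filt P R) α β γ).Nonempty :=
  ⟨FTAP.martingaleMeasures_nonempty_of_strictNoArbitrage,
    FTAP.strictNoArbitrage_of_martingaleMeasures_nonempty⟩
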